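/- Let $1<\alpha\le 2$, $a=\tan(\pi\alpha/2)$, and let $(X^{(1)},\dots,X^{(n)},S)$ be a random vector in $\mathbb R^{n+1}$ that is jointly $\alpha$-stable, $S_\alpha(\Lambda,\mu)$: for a finite (spectral) measure $\Lambda$ on the unit sphere of $\mathbb R^{n+1}$ and a vector $\mu\in\mathbb R^{n+1}$, its characteristic function is $$\tau\mapsto\exp\Big\{-\int |\langle\tau,s\rangle|^\alpha\big(1-ia\,\mathrm{sign}\langle\tau,s\rangle\big)\Lambda(ds)+i\langle\mu,\tau\rangle\Big\}.$$ Write $s=(s^{(1)},\dots,s^{(n)},s_S)$ for points of the sphere, and put $$\sigma_S^\alpha=\int|s_S|^\alpha\Lambda(ds),\qquad \beta_S=\frac1{\sigma_S^\alpha}\int\mathrm{sign}(s_S)|s_S|^\alpha\Lambda(ds),$$ $$\kappa_i=\frac{[X^{(i)},S]}{\sigma_S^\alpha}=\frac1{\sigma_S^\alpha}\int s^{(i)}|s_S|^{\alpha-1}\mathrm{sign}(s_S)\Lambda(ds),\qquad \lambda_i=\frac1{\sigma_S^\alpha}\int s^{(i)}|s_S|^{\alpha-1}\Lambda(ds),$$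 $$h(x)=\frac{\alpha}{\pi}\int_0^\infty t^{\alpha-1}e^{-\sigma_S^\alpha t^\alpha}\cos\big(xt-a\beta_S\sigma_S^\alpha t^\alpha\big)\,dt ,$$ where $\sigma_S^\alpha>0$ is assumed. Let $w$ be a measurable weight function such that $w(S)$, $Sw(S)$ and $X^{(i)}w(S)$ are integrable and $\mathbb E[w(S)]>0$, and put $$H_w[S]=\frac{\mathbb E[Sw(S)]}{\mathbb E[w(S)]},\qquad A_w[X^{(i)},S]=\frac{\mathbb E[X^{(i)}w(S)]}{\mathbb E[w(S)]}.$$ (1) If $\mu=0$, then $$A_w[X^{(i)},S]=\kappa_iH_w[S]+a\,\sigma_S^\alpha(\lambda_i-\beta_S\kappa_i)\,\frac{\int_{\mathbb R} h(x)w(x)\,dx}{\mathbb E[w(S)]},$$ where $hw$ is integrable if the coefficient $a\sigma_S^\alpha(\lambda_i-\beta_S\kappa_i)$ is nonzero (if it is zero, the last term is read as $0$). (2) Suppose that $\Lambda=\sum_{j=1}^m\gamma_j\delta_{s_j}$ is discrete, with weights $\gamma_j>0$, and that $S$ is totally skewed to the right, $\beta_S=1$. Then every atom $s_j$ has nonnegative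 $S$-coordinate and $\lambda_i=\kappa_i$. If moreover $\mu=0$, then $A_w[X^{(i)},S]=\kappa_iH_w[S]$. For arbitrary $\mu$, $X^{(i)}$ and $S$ are integrable and $$A_w[X^{(i)},S]=\mathbb E[X^{(i)}]+\kappa_i\big(H_w[S]-\mathbb E[S]\big).$$ -/

import Mathlib

open MeasureTheory
open scoped BigOperators

noncomputable section

/-- The unit sphere of `ℝ^d`, on which spectral measures live. -/
abbrev UnitSphere (d : ℕ) : Type := Metric.sphere (0 : EuclideanSpace ℝ (Fin d)) 1

/-- The constant `a = tan (π α / 2)`. -/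
def stableTan (α : ℝ) : ℝ := Real.tan (Real.pi * α / 2)

/-- `Υ_α(u) = |u|^α (1 - i a sign u)`, for an index of stability `α ≠ 1`. -/
def stableUpsilon (α u : ℝ) : ℂ :=
  ((|u| ^ α : ℝ) : ℂ) * (1 - Complex.I * (stableTan α : ℂ) * ((Real.sign u : ℝ) : ℂ))

/-- `Y ∼ S_α(Λ, μ)` for `α ≠ 1`: the random vector `Y` of `ℝ^d` has characteristic function
`τ ↦ exp (-∫ Υ_α(⟨τ, s⟩) Λ(ds) + i ⟨μ, τ⟩)`. -/
structure IsStableVector {Ω : Type*} [MeasurableSpace Ω] (P : Measure Ω) {d : ℕ} (α : ℝ)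
    (Λ : Measure (UnitSphere d)) (μ : EuclideanSpace ℝ (Fin d))
    (Y : Ω → EuclideanSpace ℝ (Fin d)) : Prop where
  aemeasurable : AEMeasurable Y P
  charFun_eq : ∀ τ : EuclideanSpace ℝ (Fin d),
    charFun (P.map Y) τ =
      Complex.exp (-(∫ s : UnitSphere d,
          stableUpsilon α (inner ℝ τ (s : EuclideanSpace ℝ (Fin d))) ∂Λ)
        + Complex.I * ((inner ℝ μ τ : ℝ) : ℂ))

/-- The vector `(X^{(1)}, …, X^{(n)}, S)`; `S` is the last coordinate. -/
def lossVector {Ω : Type*} {n : ℕ} (X : Fin n → Ω → ℝ) (S : Ω → ℝ) (ω : Ω) :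
    EuclideanSpace ℝ (Fin (n + 1)) :=
  WithLp.toLp 2 (Fin.snoc (α := fun _ => ℝ) (fun i => X i ω) (S ω))

/-- `σ_k^α = ∫ |s_k|^α Λ(ds)`, the `α`-th power of the scale of the `k`-th coordinate. -/
def scalePow {d : ℕ} (α : ℝ) (Λ : Measure (UnitSphere d)) (k : Fin d) : ℝ :=
  ∫ s : UnitSphere d, |(s : EuclideanSpace ℝ (Fin d)) k| ^ α ∂Λ

/-- `β_k = σ_k^{-α} ∫ sign(s_k) |s_k|^α Λ(ds)`, the skewness of the `k`-th coordinate. -/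
def skewness {d : ℕ} (α : ℝ) (Λ : Measure (UnitSphere d)) (k : Fin d) : ℝ :=
  (∫ s : UnitSphere d, Real.sign ((s : EuclideanSpace ℝ (Fin d)) k)
    * |(s : EuclideanSpace ℝ (Fin d)) k| ^ α ∂Λ) / scalePow α Λ k

/-- The covariation `[Y_i, Y_k] = ∫ s_i |s_k|^{α-1} sign(s_k) Λ(ds)`. -/
def covariation {d : ℕ} (α : ℝ) (Λ : Measure (UnitSphere d)) (i k : Fin d) : ℝ :=
  ∫ s : UnitSphere d, (s : EuclideanSpace ℝ (Fin d)) i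
    * |(s : EuclideanSpace ℝ (Fin d)) k| ^ (α - 1)
    * Real.sign ((s : EuclideanSpace ℝ (Fin d)) k) ∂Λ

/-- The normalized covariation `κ_{i,k} = [Y_i, Y_k] / σ_k^α`. -/
def kappaCoeff {d : ℕ} (α : ℝ) (Λ : Measure (UnitSphere d)) (i k : Fin d) : ℝ :=
  covariation α Λ i k / scalePow α Λ k

/-- `λ_{i,k} = σ_k^{-α} ∫ s_i |s_k|^{α-1} Λ(ds)`. -/
def lambdaCoeff {d : ℕ} (α : ℝ) (Λ : Measure (UnitSphere d)) (i k : Fin d) : ℝ :=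
  (∫ s : UnitSphere d, (s : EuclideanSpace ℝ (Fin d)) i
    * |(s : EuclideanSpace ℝ (Fin d)) k| ^ (α - 1) ∂Λ) / scalePow α Λ k

/-- `h(x) = (α/π) ∫_0^∞ t^{α-1} exp(-σ^α t^α) cos(x t - a β σ^α t^α) dt`; the argument
`v` is `σ^α`. -/
def stableH (α v β x : ℝ) : ℝ :=
  α / Real.pi * ∫ t in Set.Ioi (0 : ℝ), t ^ (α - 1) * Real.exp (-(v * t ^ α))
    * Real.cos (x * t - stableTan α * β * v * t ^ α)

/-- The weighted risk measure `H_w[S] = E[S w(S)] / E[w(S)]`. -/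
def weightedRisk {Ω : Type*} [MeasurableSpace Ω] (P : Measure Ω) (w : ℝ → ℝ) (S : Ω → ℝ) : ℝ :=
  (∫ ω, S ω * w (S ω) ∂P) / ∫ ω, w (S ω) ∂P

/-- The weighted allocation `A_w[X, S] = E[X w(S)] / E[w(S)]`. -/
def weightedAllocation {Ω : Type*} [MeasurableSpace Ω] (P : Measure Ω) (w : ℝ → ℝ)
    (X S : Ω → ℝ) : ℝ :=
  (∫ ω, X ω * w (S ω) ∂P) / ∫ ω, w (S ω) ∂P

/-- The discrete spectral measure `∑_j γ_j δ_{s_j}`. -/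
def discreteSpectral {d m : ℕ} (γ : Fin m → ℝ) (s : Fin m → UnitSphere d) :
    Measure (UnitSphere d) :=
  ∑ j, ENNReal.ofReal (γ j) • Measure.dirac (s j)

end

/-! ### Fourier uniqueness and inversion for signed weights. -/

section Inversion

open ProbabilityTheory Filter
open Complex (I)

variable {Ω Ω₁ Ω₂ E : Type*} [MeasurableSpace Ω] [MeasurableSpace Ω₁] [MeasurableSpace Ω₂]
  [NormedAddCommGroup E] [NormedSpace ℝ E]

/-! Since `α > 1`, the vector has finite first moments, so its characteristic function may be
differentiated at `t e_S` in the direction `e_i`. With `μ = 0` this gives `E[X_i e^{itS}] = i α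
|t|^{α-1} (sign t [X_i, S] - i a σ^α λ_i) φ_S(t)`. For `S` itself the same formula holds with `κ =
1` and `λ = β`. In the combination `X_i - κ_i S` the `sign t` terms cancel, and `E[(X_i - κ_i S)
e^{itS}] = c α |t|^{α-1} φ_S(t)`, where `c = a σ^α (λ_i - β κ_i)`
(`IsStableVector.integral_residual_smul_exp`). The right side is integrable in `t`, and its inverse
Fourier transform is `c h` (`stableH_eq_integral`). So the signed measure `E[X_i - κ_i S; S ∈ ·]`
has density `c h`, and integrating `w` against it gives (1). The inversion theorem
`integral_mul_comp_eq_integral_density` allows unbounded `w` and also yields integrability of `c h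
w`.

For (2), `β = 1` forces `s_S ≥ 0` almost everywhere for `Λ`, hence `λ_i = κ_i` and `c = 0`. The
centred residual `X_i - μ_i - κ_i (S - μ_S)` then has zero Fourier transform with respect to `S`, so
its product with any admissible `w(S)` has mean zero, whatever `μ` is; and `μ` is the vector of
means. -/

theorem integrable_map_withDensity_ofReal_iff {P : Measure Ω} {F : Ω → ℝ} (hF : AEMeasurable F P)
    {T : Ω → ℝ} (hT : AEMeasurable T P) {w : ℝ → E} (hw : StronglyMeasurable w) :
    Integrable w ((P.withDensity fun ω => ENNReal.ofReal (F ω)).map T) ↔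
      Integrable (fun ω => max (F ω) 0 • w (T ω)) P := by
  rw [integrable_map_measure hw.aestronglyMeasurable
      (hT.mono_ac (withDensity_absolutelyContinuous _ _)),
    integrable_withDensity_iff_integrable_smul₀' hF.ennreal_ofReal
      (ae_of_all _ fun _ => ENNReal.ofReal_lt_top)]
  simp only [ENNReal.toReal_ofReal', Function.comp_def]

theorem integral_map_withDensity_ofReal {P : Measure Ω} {F : Ω → ℝ} (hF : AEMeasurable F P)
    {T : Ω → ℝ} (hT : AEMeasurable T P) {w : ℝ → E} (hw : StronglyMeasurable w) :
    ∫ x, w x ∂((P.withDensity fun ω => ENNReal.ofReal (F ω)).map T) =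
      ∫ ω, max (F ω) 0 • w (T ω) ∂P := by
  rw [integral_map (hT.mono_ac (withDensity_absolutelyContinuous _ _)) hw.aestronglyMeasurable,
    integral_withDensity_eq_integral_toReal_smul₀ hF.ennreal_ofReal
      (ae_of_all _ fun _ => ENNReal.ofReal_lt_top)]
  simp only [ENNReal.toReal_ofReal']

theorem integrable_max_smul {P : Measure Ω} {F : Ω → ℝ} (hF : AEMeasurable F P)
    {w : Ω → E} (hw : AEStronglyMeasurable w P) (h : Integrable (fun ω => F ω • w ω) P) :
    Integrable (fun ω => max (F ω) 0 • w ω) P := by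
  refine h.mono ((hF.max aemeasurable_const).aestronglyMeasurable.smul hw)
    (ae_of_all _ fun ω => ?_)
  simp only [norm_smul, Real.norm_eq_abs]
  refine mul_le_mul_of_nonneg_right ?_ (norm_nonneg _)
  rcases le_total (F ω) 0 with h0 | h0
  · rw [max_eq_right h0, abs_zero]
    exact abs_nonneg _
  · rw [max_eq_left h0]

theorem integral_max_smul_sub {P : Measure Ω} {F : Ω → ℝ} (hF : AEMeasurable F P)
    {w : Ω → E} (hw : AEStronglyMeasurable w P) (h : Integrable (fun ω => F ω • w ω) P) :
    ∫ ω, max (F ω) 0 • w ω ∂P - ∫ ω, max (-F ω) 0 • w ω ∂P = ∫ ω, F ω • w ω ∂P := by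
  have hn : AEMeasurable (fun ω => -F ω) P := hF.neg
  rw [← integral_sub (integrable_max_smul hF hw h) (integrable_max_smul hn hw (by
    simpa using h.neg))]
  congr 1 with ω
  rw [← sub_smul]
  congr 1
  rcases le_total (F ω) 0 with h0 | h0 <;> simp [h0]

theorem isFiniteMeasure_map_withDensity {P : Measure Ω} {F : Ω → ℝ} (hF : Integrable F P)
    (T : Ω → ℝ) : IsFiniteMeasure ((P.withDensity fun ω => ENNReal.ofReal (F ω)).map T) := by
  have := isFiniteMeasure_withDensity_ofReal hF.2
  infer_instance

/-- Two signed weights with the same Fourier transform integrate every function alike. -/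
theorem integral_smul_comp_eq_of_integral_smul_exp_eq {P₁ : Measure Ω₁} {P₂ : Measure Ω₂}
    {F₁ T₁ : Ω₁ → ℝ} {F₂ T₂ : Ω₂ → ℝ} (hF₁ : Integrable F₁ P₁) (hF₂ : Integrable F₂ P₂)
    (hT₁ : AEMeasurable T₁ P₁) (hT₂ : AEMeasurable T₂ P₂)
    (h : ∀ t : ℝ, ∫ ω, F₁ ω • Complex.exp (t * T₁ ω * I) ∂P₁ =
      ∫ ω, F₂ ω • Complex.exp (t * T₂ ω * I) ∂P₂)
    {w : ℝ → ℝ} (hw : Measurable w) (hw₁ : Integrable (fun ω => F₁ ω * w (T₁ ω)) P₁)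
    (hw₂ : Integrable (fun ω => F₂ ω * w (T₂ ω)) P₂) :
    ∫ ω, F₁ ω * w (T₁ ω) ∂P₁ = ∫ ω, F₂ ω * w (T₂ ω) ∂P₂ := by
  -- `ENNReal.ofReal` truncates at zero, so `m` and `n` are the images under `T` of the positive and
  -- negative parts of the signed weight.
  set m₁ := (P₁.withDensity fun ω => ENNReal.ofReal (F₁ ω)).map T₁ with hm₁
  set n₁ := (P₁.withDensity fun ω => ENNReal.ofReal (-F₁ ω)).map T₁ with hn₁
  set m₂ := (P₂.withDensity fun ω => ENNReal.ofReal (F₂ ω)).map T₂ with hm₂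
  set n₂ := (P₂.withDensity fun ω => ENNReal.ofReal (-F₂ ω)).map T₂ with hn₂
  have : IsFiniteMeasure m₁ := isFiniteMeasure_map_withDensity hF₁ T₁
  have : IsFiniteMeasure n₁ := isFiniteMeasure_map_withDensity hF₁.neg T₁
  have : IsFiniteMeasure m₂ := isFiniteMeasure_map_withDensity hF₂ T₂
  have : IsFiniteMeasure n₂ := isFiniteMeasure_map_withDensity hF₂.neg T₂
  have a₁ := hF₁.aemeasurable
  have a₂ := hF₂.aemeasurable
  have b₁ : AEMeasurable (fun ω => -F₁ ω) P₁ := a₁.neg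
  have b₂ : AEMeasurable (fun ω => -F₂ ω) P₂ := a₂.neg
  have key : ∀ t : ℝ, StronglyMeasurable (fun x : ℝ => Complex.exp (t * x * I)) := fun t =>
    (by fun_prop : Continuous (fun x : ℝ => Complex.exp (t * x * I))).stronglyMeasurable
  have int₁ : ∀ t : ℝ, Integrable (fun ω => F₁ ω • Complex.exp (t * T₁ ω * I)) P₁ := fun t =>
    hF₁.norm.mono (a₁.aestronglyMeasurable.smul
      ((key t).measurable.comp_aemeasurable hT₁).aestronglyMeasurable)
      (ae_of_all _ fun ω => by
        rw [norm_smul, ← Complex.ofReal_mul, Complex.norm_exp_ofReal_mul_I]; simp)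
  have int₂ : ∀ t : ℝ, Integrable (fun ω => F₂ ω • Complex.exp (t * T₂ ω * I)) P₂ := fun t =>
    hF₂.norm.mono (a₂.aestronglyMeasurable.smul
      ((key t).measurable.comp_aemeasurable hT₂).aestronglyMeasurable)
      (ae_of_all _ fun ω => by
        rw [norm_smul, ← Complex.ofReal_mul, Complex.norm_exp_ofReal_mul_I]; simp)
  have intc : ∀ (t : ℝ) (m : Measure ℝ) [IsFiniteMeasure m],
      Integrable (fun x : ℝ => Complex.exp (t * x * I)) m := fun t m _ =>
    (integrable_const (1 : ℝ)).mono (key t).aestronglyMeasurable (ae_of_all _ fun x => by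
      rw [← Complex.ofReal_mul, Complex.norm_exp_ofReal_mul_I]; simp)
  -- Moving the negative parts across turns `m₁ - n₁ = m₂ - n₂` into an identity of finite positive
  -- measures, where characteristic functions determine the measure.
  have heq : m₁ + n₂ = m₂ + n₁ := by
    refine Measure.ext_of_charFun (funext fun t => ?_)
    rw [charFun_apply_real, charFun_apply_real, integral_add_measure (intc t _) (intc t _),
      integral_add_measure (intc t _) (intc t _)]
    have h₁ := integral_max_smul_sub a₁
      ((key t).measurable.comp_aemeasurable hT₁).aestronglyMeasurable (int₁ t)
    have h₂ := integral_max_smul_sub a₂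
      ((key t).measurable.comp_aemeasurable hT₂).aestronglyMeasurable (int₂ t)
    simp only [Function.comp_def] at h₁ h₂
    rw [hm₁, hn₁, hm₂, hn₂, integral_map_withDensity_ofReal a₁ hT₁ (key t),
      integral_map_withDensity_ofReal a₂ hT₂ (key t),
      integral_map_withDensity_ofReal b₁ hT₁ (key t),
      integral_map_withDensity_ofReal b₂ hT₂ (key t)]
    have := h t
    rw [← h₁, ← h₂] at this
    linear_combination this
  have hs := hw.stronglyMeasurable
  have s₁ := (hw.comp_aemeasurable hT₁).aestronglyMeasurable
  have s₂ := (hw.comp_aemeasurable hT₂).aestronglyMeasurable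
  have hfin : ∫ x, w x ∂(m₁ + n₂) = ∫ x, w x ∂(m₂ + n₁) := by rw [heq]
  have neg₁ : Integrable (fun ω => (-F₁ ω) • (w ∘ T₁) ω) P₁ := by simpa using hw₁.neg
  have neg₂ : Integrable (fun ω => (-F₂ ω) • (w ∘ T₂) ω) P₂ := by simpa using hw₂.neg
  rw [integral_add_measure
      ((integrable_map_withDensity_ofReal_iff a₁ hT₁ hs).2 (integrable_max_smul a₁ s₁ hw₁))
      ((integrable_map_withDensity_ofReal_iff b₂ hT₂ hs).2
        (integrable_max_smul b₂ s₂ neg₂)),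
    integral_add_measure
      ((integrable_map_withDensity_ofReal_iff a₂ hT₂ hs).2 (integrable_max_smul a₂ s₂ hw₂))
      ((integrable_map_withDensity_ofReal_iff b₁ hT₁ hs).2
        (integrable_max_smul b₁ s₁ neg₁)),
    integral_map_withDensity_ofReal a₁ hT₁ hs,
      integral_map_withDensity_ofReal a₂ hT₂ hs,
      integral_map_withDensity_ofReal b₁ hT₁ hs,
      integral_map_withDensity_ofReal b₂ hT₂ hs] at hfin
  have h₁ := integral_max_smul_sub a₁ s₁ hw₁
  have h₂ := integral_max_smul_sub a₂ s₂ hw₂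
  simp only [Function.comp_def, smul_eq_mul] at h₁ h₂ hfin
  linarith

/-- The Gaussian is its own Fourier transform up to a constant. Multiplying by `G(S)` is therefore
averaging over the frequencies `e^{izS}`, which smooths the transform `g` into `z ↦ g(t + z)`
averaged over a normal `z`. -/
theorem gaussianPDFReal_eq_charFun (s : ℝ) :
    ((gaussianPDFReal 0 1 s : ℝ) : ℂ) =
      (((Real.sqrt (2 * Real.pi))⁻¹ : ℝ) : ℂ) * charFun (gaussianReal 0 1) s := by
  rw [charFun_gaussianReal, gaussianPDFReal]
  push_cast
  simp [neg_div]

theorem gaussianPDFReal_zero_neg (s : ℝ) :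
    gaussianPDFReal 0 1 (-s) = gaussianPDFReal 0 1 s := by
  simp [gaussianPDFReal]

theorem norm_smul_exp_mul_I (r t x : ℝ) : ‖r • Complex.exp (t * x * I)‖ = |r| := by
  rw [norm_smul, ← Complex.ofReal_mul, Complex.norm_exp_ofReal_mul_I, mul_one, Real.norm_eq_abs]

/-- The Fourier transform of the Gaussian-smoothed weight. -/
theorem integral_smul_gaussianPDFReal_exp {P : Measure Ω} [SFinite P] {f S : Ω → ℝ}
    (hf : Integrable f P) (hS : AEMeasurable S P) {g : ℝ → ℂ}
    (hg : ∀ t : ℝ, ∫ ω, f ω • Complex.exp (t * S ω * I) ∂P = g t) (t : ℝ) :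
    ∫ ω, (f ω * gaussianPDFReal 0 1 (S ω)) • Complex.exp (t * S ω * I) ∂P =
      (((Real.sqrt (2 * Real.pi))⁻¹ : ℝ) : ℂ) * ∫ z, g (t + z) ∂(gaussianReal 0 1) := by
  have hint : Integrable (Function.uncurry fun (ω : Ω) (z : ℝ) =>
      f ω • Complex.exp ((t + z : ℝ) * S ω * I)) (P.prod (gaussianReal 0 1)) := by
    refine (hf.norm.comp_fst (gaussianReal 0 1)).mono ?_ (ae_of_all _ fun p => ?_)
    · have h1 : AEMeasurable (fun p : Ω × ℝ => f p.1) (P.prod (gaussianReal 0 1)) :=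
        hf.aemeasurable.comp_fst
      have h2 : AEMeasurable (fun p : Ω × ℝ => S p.1) (P.prod (gaussianReal 0 1)) :=
        hS.comp_fst
      have h3 : AEMeasurable (fun p : Ω × ℝ => p.2) (P.prod (gaussianReal 0 1)) :=
        measurable_snd.aemeasurable
      refine AEMeasurable.aestronglyMeasurable ?_
      simp only [Function.uncurry_def]
      fun_prop
    · simp only [Function.uncurry_def, norm_smul_exp_mul_I]
      simp
  calc _ = ∫ ω, (((Real.sqrt (2 * Real.pi))⁻¹ : ℝ) : ℂ) *
        ∫ z, f ω • Complex.exp ((t + z : ℝ) * S ω * I) ∂(gaussianReal 0 1) ∂P := by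
        congr 1 with ω
        rw [Complex.real_smul, Complex.ofReal_mul, gaussianPDFReal_eq_charFun, charFun_apply_real,
          integral_smul, Complex.real_smul]
        have : ∀ z : ℝ, Complex.exp ((t + z : ℝ) * S ω * I) =
            Complex.exp (t * S ω * I) * Complex.exp (S ω * z * I) := fun z => by
          rw [← Complex.exp_add]; congr 1; push_cast; ring
        simp_rw [this, integral_const_mul]
        ring
    _ = _ := by
        rw [integral_const_mul, integral_integral_swap hint]
        simp_rw [hg]

/-- The Fourier transform of a Gaussian-smoothed inverse transform. -/
theorem integral_gaussianReal_smul_exp {g : ℝ → ℂ} (hg : Integrable g) {h : ℝ → ℝ}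
    (hh : ∀ x : ℝ, (h x : ℂ) = ((2 * Real.pi)⁻¹ : ℝ) * ∫ u : ℝ, g u * Complex.exp (-(u * x * I)))
    (t : ℝ) :
    ∫ x, h x • Complex.exp (t * x * I) ∂(gaussianReal 0 1) =
      (((Real.sqrt (2 * Real.pi))⁻¹ : ℝ) : ℂ) * ∫ z, g (t + z) ∂(gaussianReal 0 1) := by
  have hint : Integrable (Function.uncurry fun (x : ℝ) (u : ℝ) =>
      g u * Complex.exp ((t - u : ℝ) * x * I)) ((gaussianReal 0 1).prod volume) := by
    refine (hg.norm.comp_snd (gaussianReal 0 1)).mono ?_ (ae_of_all _ fun p => ?_)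
    · have h1 : AEMeasurable (fun p : ℝ × ℝ => g p.2) ((gaussianReal 0 1).prod volume) :=
        hg.aemeasurable.comp_snd
      refine AEMeasurable.aestronglyMeasurable ?_
      simp only [Function.uncurry_def]
      fun_prop
    · simp only [Function.uncurry_def, norm_mul]
      rw [← Complex.ofReal_mul, Complex.norm_exp_ofReal_mul_I]
      simp
  have hpi : Real.sqrt (2 * Real.pi) * Real.sqrt (2 * Real.pi) = 2 * Real.pi :=
    Real.mul_self_sqrt (by positivity)
  calc _ = ∫ x : ℝ, (((2 * Real.pi)⁻¹ : ℝ) : ℂ) *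
        (∫ u : ℝ, g u * Complex.exp ((t - u : ℝ) * x * I)) ∂(gaussianReal 0 1) := by
        congr 1 with x
        rw [Complex.real_smul, hh, mul_assoc, ← integral_mul_const]
        congr 2 with u
        rw [mul_assoc, ← Complex.exp_add]
        congr 2; push_cast; ring
    _ = (((2 * Real.pi)⁻¹ : ℝ) : ℂ) * ∫ u : ℝ, g u * charFun (gaussianReal 0 1) (t - u) := by
        rw [integral_const_mul, integral_integral_swap hint]
        simp_rw [integral_const_mul, charFun_apply_real]
    _ = (((Real.sqrt (2 * Real.pi))⁻¹ : ℝ) : ℂ) *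
          ∫ u : ℝ, g u * (gaussianPDFReal 0 1 (u - t) : ℝ) := by
        rw [← integral_const_mul, ← integral_const_mul]
        congr 1 with u
        rw [← gaussianPDFReal_zero_neg, gaussianPDFReal_eq_charFun, neg_sub]
        -- One factor `(2π)^{-1/2}` normalizes the Gaussian density, the other remains in front.
        have : (2 * Real.pi)⁻¹ = (Real.sqrt (2 * Real.pi))⁻¹ * (Real.sqrt (2 * Real.pi))⁻¹ := by
          rw [← mul_inv, hpi]
        rw [this, Complex.ofReal_mul]
        ring
    _ = _ := by
        rw [integral_gaussianReal_eq_integral_smul one_ne_zero,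
          ← integral_add_left_eq_self _ t]
        congr 2 with z
        rw [add_sub_cancel_left, Complex.real_smul, mul_comm]

/-- Fourier inversion for signed weights: if the Fourier transform `g` of `f` with respect to `S`
is integrable, then `f` has the density `h` given by the inversion formula. -/
theorem integral_mul_comp_eq_integral_density {P : Measure Ω} [SFinite P] {f S : Ω → ℝ}
    (hf : Integrable f P) (hS : AEMeasurable S P) {g : ℝ → ℂ} (hgi : Integrable g)
    (hg : ∀ t : ℝ, ∫ ω, f ω • Complex.exp (t * S ω * I) ∂P = g t) {h : ℝ → ℝ}
    (hh : ∀ x : ℝ, (h x : ℂ) = ((2 * Real.pi)⁻¹ : ℝ) * ∫ u : ℝ, g u * Complex.exp (-(u * x * I)))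
    {w : ℝ → ℝ} (hw : Measurable w) (hfw : Integrable (fun ω => f ω * w (S ω)) P) :
    Integrable (fun x => h x * w x) ∧ ∫ ω, f ω * w (S ω) ∂P = ∫ x, h x * w x := by
  -- The density `h` is bounded but not known to be Lebesgue integrable, so the uniqueness theorem
  -- does not apply to it directly. With the Gaussian factor `G`, both `f G(S)` under `P` and `h`
  -- under `N` are integrable weights, with equal transforms.
  set N := gaussianReal 0 1 with hN
  set G := gaussianPDFReal 0 1 with hG
  have hGpos : ∀ x, 0 < G x := fun x => gaussianPDFReal_pos 0 1 x one_ne_zero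
  have hGm : Measurable G := measurable_gaussianPDFReal 0 1
  have hGle : ∀ x, G x ≤ (Real.sqrt (2 * Real.pi))⁻¹ := fun x => by
    rw [hG, gaussianPDFReal]
    have : Real.exp (-(x - 0) ^ 2 / (2 * ((1 : NNReal) : ℝ))) ≤ 1 := by
      rw [Real.exp_le_one_iff]
      norm_num
      nlinarith [sq_nonneg x]
    calc _ ≤ (Real.sqrt (2 * Real.pi * ((1 : NNReal) : ℝ)))⁻¹ * 1 := by gcongr
      _ = _ := by simp
  have hN_iff : ∀ v : ℝ → ℝ, Integrable v N ↔ Integrable (fun x => G x * v x) := fun v => by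
    rw [hN, gaussianReal_of_var_ne_zero _ one_ne_zero,
      integrable_withDensity_iff_integrable_smul' (measurable_gaussianPDF 0 1)
        (ae_of_all _ fun _ => gaussianPDF_lt_top)]
    simp only [toReal_gaussianPDF, smul_eq_mul, hG]
  have hnorm : ∀ x u : ℝ, ‖g u * Complex.exp (-(u * x * I))‖ = ‖g u‖ := fun x u => by
    rw [norm_mul, ← Complex.ofReal_mul, ← neg_mul, ← Complex.ofReal_neg,
      Complex.norm_exp_ofReal_mul_I, mul_one]
  have hhm : Measurable h := by
    have : Continuous fun x : ℝ => ∫ u : ℝ, g u * Complex.exp (-(u * x * I)) := by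
      refine continuous_of_dominated (bound := fun u => ‖g u‖) (fun x => ?_)
        (fun x => ae_of_all _ fun u => (hnorm x u).le) hgi.norm
        (ae_of_all _ fun u => by fun_prop)
      exact hgi.aestronglyMeasurable.mul (by fun_prop)
    have h' : h = fun x : ℝ => ((((2 * Real.pi)⁻¹ : ℝ) : ℂ) *
        ∫ u : ℝ, g u * Complex.exp (-(u * x * I))).re := by
      ext x
      rw [← hh, Complex.ofReal_re]
    rw [h']
    exact (Complex.continuous_re.comp (continuous_const.mul this)).measurable
  have hhb : ∀ x, |h x| ≤ (2 * Real.pi)⁻¹ * ∫ u, ‖g u‖ := fun x => by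
    rw [← Real.norm_eq_abs, ← Complex.norm_real, hh, norm_mul, Complex.norm_real,
      Real.norm_of_nonneg (by positivity)]
    gcongr
    refine (norm_integral_le_integral_norm _).trans_eq ?_
    simp_rw [hnorm]
  have hhN : ∀ v : ℝ → ℝ, Measurable v → (∃ k, ∀ x, |v x| ≤ k) →
      Integrable (fun x => h x * v x) N := fun v hv ⟨k, hk⟩ => by
    refine Integrable.of_bound (hhm.mul hv).aestronglyMeasurable
      (((2 * Real.pi)⁻¹ * ∫ u, ‖g u‖) * k) (ae_of_all _ fun x => ?_)
    rw [norm_mul]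
    exact mul_le_mul (hhb x) (hk x) (norm_nonneg _) ((abs_nonneg _).trans (hhb x))
  have hfG : Integrable (fun ω => f ω * G (S ω)) P := by
    refine hf.mul_bdd (c := (Real.sqrt (2 * Real.pi))⁻¹)
      (hGm.comp_aemeasurable hS).aestronglyMeasurable (ae_of_all _ fun ω => ?_)
    rw [Real.norm_of_nonneg (hGpos _).le]
    exact hGle _
  have hkey : ∀ v : ℝ → ℝ, Measurable v → Integrable (fun ω => f ω * G (S ω) * v (S ω)) P →
      Integrable (fun x => h x * v x) N →
      ∫ ω, f ω * G (S ω) * v (S ω) ∂P = ∫ x, G x * (h x * v x) := fun v hv h₁ h₂ => by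
    have := integral_smul_comp_eq_of_integral_smul_exp_eq (T₂ := id) hfG
      (by simpa using hhN (fun _ => 1) measurable_const ⟨1, by simp⟩) hS aemeasurable_id
      (fun t => (integral_smul_gaussianPDFReal_exp hf hS hg t).trans
        (integral_gaussianReal_smul_exp hgi hh t).symm) hv h₁ h₂
    rw [this, integral_gaussianReal_eq_integral_smul one_ne_zero]
    rfl
  -- On `A k` the quotient `|w| / G` is bounded, so it is an admissible test function there; the
  -- sets exhaust the line.
  set A : ℕ → Set ℝ := fun k => {x | |w x| / G x ≤ k} with hA
  have hAm : ∀ k, MeasurableSet (A k) := fun k =>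
    measurableSet_le (hw.abs.div hGm) measurable_const
  have hcover : AECover volume atTop A := by
    refine ⟨ae_of_all _ fun x => ?_, hAm⟩
    obtain ⟨k, hk⟩ := exists_nat_ge (|w x| / G x)
    filter_upwards [eventually_ge_atTop k] with j hj
    exact hk.trans (by exact_mod_cast hj)
  -- A sign of `h` that never vanishes: testing with `e |w| / G` on `A k` produces `∫_{A k} |h w|`.
  set e : ℝ → ℝ := fun x => if 0 ≤ h x then 1 else -1 with he
  have hem : Measurable e :=
    Measurable.ite (measurableSet_le measurable_const hhm) measurable_const measurable_const
  have heh : ∀ x, h x * e x = |h x| := fun x => by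
    by_cases h0 : 0 ≤ h x
    · simp [he, h0, abs_of_nonneg h0]
    · simp [he, h0, abs_of_neg (not_le.1 h0)]
  have hea : ∀ x, |e x| = 1 := fun x => by
    by_cases h0 : 0 ≤ h x <;> simp [he, h0]
  have hvm : ∀ k, Measurable ((A k).indicator fun x => e x * (|w x| / G x)) := fun k =>
    (hem.mul (hw.abs.div hGm)).indicator (hAm k)
  have hvb : ∀ k x, |(A k).indicator (fun x => e x * (|w x| / G x)) x| ≤ k := fun k x => by
    by_cases hx : x ∈ A k
    · rw [Set.indicator_of_mem hx, abs_mul, hea, one_mul, abs_of_nonneg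
        (div_nonneg (abs_nonneg _) (hGpos x).le)]
      exact hx
    · rw [Set.indicator_of_notMem hx]
      simp
  have hGv : ∀ k x, G x * (h x * (A k).indicator (fun x => e x * (|w x| / G x)) x) =
      (A k).indicator (fun x => ‖h x * w x‖) x := fun k x => by
    by_cases hx : x ∈ A k
    · rw [Set.indicator_of_mem hx, Set.indicator_of_mem hx, ← mul_assoc (h x), heh, norm_mul,
        Real.norm_eq_abs, Real.norm_eq_abs]
      have := (hGpos x).ne'
      field_simp
    · simp [Set.indicator_of_notMem hx]
  -- The integrals of `|h w|` over the `A k` are all bounded by `E|f w(S)|`.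
  have hhw : Integrable (fun x => h x * w x) := by
    refine hcover.integrable_of_integral_norm_bounded (∫ ω, |f ω * w (S ω)| ∂P) (fun k => ?_)
      (Eventually.of_forall fun k => ?_)
    · have := (hN_iff _).1 (hhN _ (hvm k) ⟨k, hvb k⟩)
      simp_rw [hGv] at this
      rw [integrable_indicator_iff (hAm k)] at this
      exact (integrable_norm_iff (hhm.mul hw).aestronglyMeasurable).1 this
    · have hi : Integrable (fun ω => f ω * G (S ω) *
          (A k).indicator (fun x => e x * (|w x| / G x)) (S ω)) P :=
        hfG.mul_bdd (c := k) ((hvm k).comp_aemeasurable hS).aestronglyMeasurable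
          (ae_of_all _ fun ω => hvb k _)
      rw [← integral_indicator (hAm k)]
      simp_rw [← hGv]
      rw [← hkey _ (hvm k) hi (hhN _ (hvm k) ⟨k, hvb k⟩)]
      refine integral_mono hi hfw.abs fun ω => (le_abs_self _).trans ?_
      by_cases hx : S ω ∈ A k
      · simp only [Set.indicator_of_mem hx, abs_mul, hea, abs_div, abs_abs]
        rw [abs_of_pos (hGpos _)]
        have := (hGpos (S ω)).ne'
        apply le_of_eq
        field_simp
      · simp only [Set.indicator_of_notMem hx, mul_zero, abs_zero]
        positivity
  refine ⟨hhw, ?_⟩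
  have hG1 : ∀ x y, G x * (y * (w x / G x)) = y * w x := fun x y => by
    have := (hGpos x).ne'
    field_simp
  have hG2 : ∀ x y, y * G x * (w x / G x) = y * w x := fun x y => by
    have := (hGpos x).ne'
    field_simp
  -- Dividing by `G` removes the smoothing.
  have := hkey (fun x => w x / G x) (hw.div hGm) (by simpa only [hG2] using hfw)
    ((hN_iff _).2 (by simpa only [hG1] using hhw))
  simpa only [hG1, hG2] using this

end Inversion

/-! ### Calculus of the stable exponent `Υ_α`. -/

section Upsilon

open Filter Topology
open Complex (I)

theorem Real.measurable_sign : Measurable Real.sign := by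
  unfold Real.sign
  exact Measurable.ite measurableSet_Iio measurable_const
    (Measurable.ite measurableSet_Ioi measurable_const measurable_const)

theorem Real.sign_mul (x y : ℝ) : Real.sign (x * y) = Real.sign x * Real.sign y := by
  rcases lt_trichotomy x 0 with hx | rfl | hx <;> rcases lt_trichotomy y 0 with hy | rfl | hy <;>
    simp [Real.sign_of_pos, Real.sign_of_neg, Real.sign_zero, mul_pos_of_neg_of_neg,
      mul_neg_of_neg_of_pos, mul_neg_of_pos_of_neg, *]

theorem Real.abs_sign_le_one (x : ℝ) : |Real.sign x| ≤ 1 := by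
  rcases Real.sign_apply_eq x with h | h | h <;> simp [h]

theorem Real.mul_sign_self (x : ℝ) : x * Real.sign x = |x| := by
  rcases lt_trichotomy x 0 with hx | rfl | hx
  · rw [Real.sign_of_neg hx, abs_of_neg hx]; ring
  · simp
  · rw [Real.sign_of_pos hx, abs_of_pos hx]; ring

theorem Real.abs_mul_sign_self (x : ℝ) : |x| * Real.sign x = x := by
  rcases lt_trichotomy x 0 with hx | rfl | hx
  · rw [Real.sign_of_neg hx, abs_of_neg hx]; ring
  · simp
  · rw [Real.sign_of_pos hx, abs_of_pos hx]; ring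

theorem Real.eventuallyEq_sign {u : ℝ} (hu : u ≠ 0) :
    Real.sign =ᶠ[𝓝 u] fun _ => Real.sign u := by
  rcases lt_or_gt_of_ne hu with h | h
  · filter_upwards [Iio_mem_nhds h] with x hx
    rw [Real.sign_of_neg hx, Real.sign_of_neg h]
  · filter_upwards [Ioi_mem_nhds h] with x hx
    rw [Real.sign_of_pos hx, Real.sign_of_pos h]

theorem abs_rpow_eq_mul {α : ℝ} (hα : 1 < α) (u : ℝ) : |u| ^ α = |u| ^ (α - 1) * |u| := by
  conv_lhs => rw [show α = (α - 1) + 1 by ring]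
  rw [Real.rpow_add_of_nonneg (abs_nonneg u) (by linarith) zero_le_one, Real.rpow_one]

theorem hasDerivAt_abs_rpow_sign {α : ℝ} (hα : 1 < α) (u : ℝ) :
    HasDerivAt (fun x : ℝ => |x| ^ α) (α * |u| ^ (α - 1) * Real.sign u) u := by
  convert hasDerivAt_abs_rpow u hα using 1
  rcases eq_or_ne u 0 with rfl | hu
  · simp
  · rw [show α - 1 = (α - 2) + 1 by ring, Real.rpow_add_one (abs_ne_zero.2 hu)]
    linear_combination (α * |u| ^ (α - 2)) * Real.abs_mul_sign_self u

/-- The jump of the sign at `0` does no harm: the difference quotient there is `|t|^{α-1}`, which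
tends to `0` because `α > 1`. Elsewhere the sign is locally constant with square `1`. -/
theorem hasDerivAt_abs_rpow_mul_sign {α : ℝ} (hα : 1 < α) (u : ℝ) :
    HasDerivAt (fun x : ℝ => |x| ^ α * Real.sign x) (α * |u| ^ (α - 1)) u := by
  rcases eq_or_ne u 0 with rfl | hu
  · have h0 : (0 : ℝ) < α - 1 := by linarith
    rw [abs_zero, Real.zero_rpow h0.ne', mul_zero, hasDerivAt_iff_tendsto_slope_zero]
    have hc : Tendsto (fun t : ℝ => |t| ^ (α - 1)) (𝓝[≠] 0) (𝓝 0) := by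
      have : ContinuousAt (fun t : ℝ => |t| ^ (α - 1)) 0 :=
        continuous_abs.continuousAt.rpow_const (Or.inr h0.le)
      have h := this.tendsto
      simp only [abs_zero, Real.zero_rpow h0.ne'] at h
      exact h.mono_left nhdsWithin_le_nhds
    refine hc.congr' ?_
    filter_upwards [self_mem_nhdsWithin] with t ht
    have ht : t ≠ 0 := ht
    simp only [zero_add, Real.sign_zero, mul_zero, sub_zero, smul_eq_mul]
    rw [abs_rpow_eq_mul hα, mul_assoc, Real.abs_mul_sign_self]
    field_simp
  · have h := (hasDerivAt_abs_rpow_sign hα u).mul_const (Real.sign u)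
    refine (h.congr_of_eventuallyEq ?_).congr_deriv ?_
    · filter_upwards [Real.eventuallyEq_sign hu] with x hx
      rw [hx]
    · rcases Real.sign_apply_eq_of_ne_zero u hu with h | h <;> simp [h]

/-- The derivative `α |u|^{α-1} (sign u - i a)` of `Υ_α`. -/
noncomputable def stableUpsilonDeriv (α u : ℝ) : ℂ :=
  ((α * |u| ^ (α - 1) * Real.sign u : ℝ) : ℂ)
    - I * (stableTan α : ℂ) * ((α * |u| ^ (α - 1) : ℝ) : ℂ)

theorem stableUpsilon_eq (α u : ℝ) :
    stableUpsilon α u = ((|u| ^ α : ℝ) : ℂ)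
      - I * (stableTan α : ℂ) * ((|u| ^ α * Real.sign u : ℝ) : ℂ) := by
  rw [stableUpsilon]
  push_cast
  ring

theorem hasDerivAt_stableUpsilon {α : ℝ} (hα : 1 < α) (u : ℝ) :
    HasDerivAt (stableUpsilon α) (stableUpsilonDeriv α u) u := by
  have h := (hasDerivAt_abs_rpow_sign hα u).ofReal_comp.sub
    ((hasDerivAt_abs_rpow_mul_sign hα u).ofReal_comp.const_mul (I * (stableTan α : ℂ)))
  exact h.congr_of_eventuallyEq (Eventually.of_forall fun x => stableUpsilon_eq α x)

theorem continuous_stableUpsilon {α : ℝ} (hα : 1 < α) : Continuous (stableUpsilon α) :=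
  continuous_iff_continuousAt.2 fun u => (hasDerivAt_stableUpsilon hα u).continuousAt

theorem measurable_stableUpsilonDeriv (α : ℝ) : Measurable (stableUpsilonDeriv α) := by
  have := Real.measurable_sign
  unfold stableUpsilonDeriv
  fun_prop

theorem norm_stableUpsilon_le (α u : ℝ) :
    ‖stableUpsilon α u‖ ≤ |u| ^ α * (1 + |stableTan α|) := by
  have h0 : (0 : ℝ) ≤ |u| ^ α := by positivity
  rw [stableUpsilon, norm_mul, Complex.norm_real, Real.norm_of_nonneg h0]
  gcongr
  refine (norm_sub_le _ _).trans ?_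
  simp only [norm_one, norm_mul, Complex.norm_I, one_mul, Complex.norm_real, Real.norm_eq_abs]
  gcongr
  exact mul_le_of_le_one_right (abs_nonneg _) (Real.abs_sign_le_one u)

theorem norm_stableUpsilonDeriv_le {α : ℝ} (hα : 1 < α) {u R : ℝ} (hu : |u| ≤ R) :
    ‖stableUpsilonDeriv α u‖ ≤ α * R ^ (α - 1) * (1 + |stableTan α|) := by
  have h1 : |u| ^ (α - 1) ≤ R ^ (α - 1) :=
    Real.rpow_le_rpow (abs_nonneg u) hu (by linarith)
  have h0 : (0 : ℝ) ≤ |u| ^ (α - 1) := by positivity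
  have hα0 : 0 < α := by linarith
  have hR : 0 ≤ R := (abs_nonneg u).trans hu
  have : stableUpsilonDeriv α u = ((α * |u| ^ (α - 1) : ℝ) : ℂ) *
      ((Real.sign u : ℝ) - I * (stableTan α : ℂ)) := by
    rw [stableUpsilonDeriv]; push_cast; ring
  rw [this, norm_mul, Complex.norm_real, Real.norm_of_nonneg (by positivity)]
  have hn : ‖((Real.sign u : ℝ) : ℂ) - I * (stableTan α : ℂ)‖ ≤ 1 + |stableTan α| := by
    refine (norm_sub_le _ _).trans ?_
    simp only [norm_mul, Complex.norm_I, one_mul, Complex.norm_real, Real.norm_eq_abs]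
    gcongr
    exact Real.abs_sign_le_one u
  gcongr

/-- Homogeneity: on a coordinate axis `⟨τ, s⟩ = t s_k`, so `t` can be pulled out of the spectral
integral. -/
theorem stableUpsilon_mul (α t u : ℝ) :
    stableUpsilon α (t * u) = ((|t| ^ α : ℝ) : ℂ) * (((|u| ^ α : ℝ) : ℂ)
      - I * (stableTan α : ℂ) * ((Real.sign t : ℝ) : ℂ) *
        ((Real.sign u * |u| ^ α : ℝ) : ℂ)) := by
  rw [stableUpsilon_eq, Real.sign_mul, abs_mul, Real.mul_rpow (abs_nonneg _) (abs_nonneg _)]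
  push_cast
  ring

theorem stableUpsilonDeriv_mul (α t u : ℝ) :
    stableUpsilonDeriv α (t * u) = ((α * |t| ^ (α - 1) : ℝ) : ℂ) *
      (((Real.sign t : ℝ) : ℂ) * ((|u| ^ (α - 1) * Real.sign u : ℝ) : ℂ)
      - I * (stableTan α : ℂ) * ((|u| ^ (α - 1) : ℝ) : ℂ)) := by
  rw [stableUpsilonDeriv, Real.sign_mul, abs_mul, Real.mul_rpow (abs_nonneg _) (abs_nonneg _)]
  push_cast
  ring

end Upsilon

/-! ### First moments from the behaviour of the characteristic function at zero. -/

section Moment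

open Filter Topology

/-- A probability measure on `ℝ` whose characteristic function satisfies
`1 - φ(t) = O(|t|^α)` with `α > 1` has a finite first moment. -/
theorem integrable_id_of_norm_one_sub_charFun_le {ν : Measure ℝ} [IsProbabilityMeasure ν]
    {α C : ℝ} (hα : 1 < α) (hC : 0 ≤ C) (h : ∀ t, ‖1 - charFun ν t‖ ≤ C * |t| ^ α) :
    Integrable (fun x => x) ν := by
  -- The tail is at most `(r/2) ‖∫ (1 - φ)‖` over an interval of length `4/r`, on which `‖1 - φ‖ ≤ C
  -- (2/r)^α`.
  have htail : ∀ r : ℝ, 0 < r → ν.real {x | r < |x|} ≤ (2 * C * 2 ^ α) * r ^ (-α) := by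
    intro r hr
    refine (measureReal_abs_gt_le_integral_charFun hr).trans ?_
    have hb : ‖∫ t in (-2 * r⁻¹)..(2 * r⁻¹), 1 - charFun ν t‖ ≤
        (C * (2 * r⁻¹) ^ α) * |2 * r⁻¹ - -2 * r⁻¹| := by
      refine intervalIntegral.norm_integral_le_of_norm_le_const fun t ht => (h t).trans ?_
      have hr' : 0 < r⁻¹ := inv_pos.2 hr
      rw [Set.uIoc_of_le (by linarith)] at ht
      have : |t| ≤ 2 * r⁻¹ := abs_le.2 ⟨by linarith [ht.1], ht.2⟩
      gcongr
    calc _ ≤ 2⁻¹ * r * ((C * (2 * r⁻¹) ^ α) * |2 * r⁻¹ - -2 * r⁻¹|) := by gcongr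
      _ = _ := by
        rw [show 2 * r⁻¹ - -2 * r⁻¹ = 4 * r⁻¹ by ring, abs_of_pos (by positivity),
          Real.mul_rpow zero_le_two (by positivity), Real.inv_rpow hr.le, Real.rpow_neg hr.le]
        field_simp
        ring
  refine ⟨measurable_id.aestronglyMeasurable, ?_⟩
  rw [hasFiniteIntegral_iff_norm]
  simp only [Real.norm_eq_abs]
  -- Layer-cake formula: the tail is at most `1` up to `r = 1`, and beyond it `r^{-α}` is integrable
  -- because `α > 1`.
  rw [lintegral_eq_lintegral_meas_lt ν (ae_of_all _ fun x => abs_nonneg x)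
    measurable_id.abs.aemeasurable, ← Set.Ioc_union_Ioi_eq_Ioi (zero_le_one' ℝ)]
  refine (lintegral_union_le _ _ _).trans_lt (ENNReal.add_lt_top.2 ⟨?_, ?_⟩)
  · calc _ ≤ ∫⁻ _ in Set.Ioc (0 : ℝ) 1, 1 := lintegral_mono fun _ => prob_le_one
      _ < ⊤ := by simp
  · have hi : IntegrableOn (fun r : ℝ => (2 * C * 2 ^ α) * r ^ (-α)) (Set.Ioi 1) :=
      (integrableOn_Ioi_rpow_of_lt (by linarith) one_pos).const_mul _
    refine lt_of_le_of_lt (setLIntegral_mono' measurableSet_Ioi fun r hr => ?_)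
      hi.lintegral_lt_top
    rw [← ofReal_measureReal]
    exact ENNReal.ofReal_le_ofReal (htail r (one_pos.trans hr))

end Moment

/-! ### Integrability of stable vectors and the derivative of their characteristic function. -/

section StableVector

open Filter Topology
open Complex (I)

variable {d : ℕ}

theorem norm_coe_unitSphere (s : UnitSphere d) : ‖(s : EuclideanSpace ℝ (Fin d))‖ = 1 :=
  norm_eq_of_mem_sphere s

theorem abs_inner_unitSphere_le (v : EuclideanSpace ℝ (Fin d)) (s : UnitSphere d) :
    |inner ℝ v (s : EuclideanSpace ℝ (Fin d))| ≤ ‖v‖ :=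
  (abs_real_inner_le_norm _ _).trans_eq (by rw [norm_coe_unitSphere, mul_one])

theorem continuous_inner_unitSphere (v : EuclideanSpace ℝ (Fin d)) :
    Continuous fun s : UnitSphere d => inner ℝ v (s : EuclideanSpace ℝ (Fin d)) :=
  continuous_const.inner continuous_subtype_val

theorem integrable_stableUpsilon {α : ℝ} (hα : 1 < α) (Λ : Measure (UnitSphere d))
    [IsFiniteMeasure Λ] (v : EuclideanSpace ℝ (Fin d)) :
    Integrable (fun s : UnitSphere d =>
      stableUpsilon α (inner ℝ v (s : EuclideanSpace ℝ (Fin d)))) Λ := by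
  refine Integrable.of_bound
    ((continuous_stableUpsilon hα).comp (continuous_inner_unitSphere v)).aestronglyMeasurable
    (‖v‖ ^ α * (1 + |stableTan α|)) (ae_of_all _ fun s => (norm_stableUpsilon_le _ _).trans ?_)
  have := abs_inner_unitSphere_le v s
  have hα0 : 0 < α := by linarith
  gcongr

/-- For `|ε| < 1` the inner product stays within `‖τ‖ + ‖v‖` on the whole sphere, so the derivative
of the integrand is dominated by a constant, integrable for the finite `Λ`. -/
theorem hasDerivAt_integral_stableUpsilon {α : ℝ} (hα : 1 < α) (Λ : Measure (UnitSphere d))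
    [IsFiniteMeasure Λ] (τ v : EuclideanSpace ℝ (Fin d)) :
    HasDerivAt (fun ε : ℝ => ∫ s : UnitSphere d,
        stableUpsilon α (inner ℝ (τ + ε • v) (s : EuclideanSpace ℝ (Fin d))) ∂Λ)
      (∫ s : UnitSphere d, inner ℝ v (s : EuclideanSpace ℝ (Fin d)) •
        stableUpsilonDeriv α (inner ℝ τ (s : EuclideanSpace ℝ (Fin d))) ∂Λ) 0 := by
  have hα0 : 0 < α := by linarith
  have h := (hasDerivAt_integral_of_dominated_loc_of_deriv_le
    (F := fun (ε : ℝ) (s : UnitSphere d) =>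
      stableUpsilon α (inner ℝ (τ + ε • v) (s : EuclideanSpace ℝ (Fin d))))
    (F' := fun (ε : ℝ) (s : UnitSphere d) => inner ℝ v (s : EuclideanSpace ℝ (Fin d)) •
        stableUpsilonDeriv α (inner ℝ (τ + ε • v) (s : EuclideanSpace ℝ (Fin d))))
    (bound := fun _ => ‖v‖ * (α * (‖τ‖ + ‖v‖) ^ (α - 1) * (1 + |stableTan α|)))
    (μ := Λ) (x₀ := (0 : ℝ)) (Metric.ball_mem_nhds 0 one_pos)
    (Eventually.of_forall fun ε => (integrable_stableUpsilon hα Λ _).aestronglyMeasurable)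
    (integrable_stableUpsilon hα Λ _) ?_ (ae_of_all _ fun s ε hε => ?_)
    (integrable_const _) (ae_of_all _ fun s ε _ => ?_)).2
  · simpa only [zero_smul, add_zero] using h
  · exact (continuous_inner_unitSphere v).aestronglyMeasurable.smul
      ((measurable_stableUpsilonDeriv α).comp
        (continuous_inner_unitSphere _).measurable).aestronglyMeasurable
  · rw [norm_smul, Real.norm_eq_abs]
    have hε1 : |ε| ≤ 1 := by
      rw [mem_ball_zero_iff, Real.norm_eq_abs] at hε
      exact hε.le
    refine mul_le_mul (abs_inner_unitSphere_le v s) (norm_stableUpsilonDeriv_le hα ?_)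
      (norm_nonneg _) (norm_nonneg _)
    refine (abs_inner_unitSphere_le _ s).trans ((norm_add_le _ _).trans ?_)
    rw [norm_smul, Real.norm_eq_abs]
    gcongr
    exact mul_le_of_le_one_left (norm_nonneg _) hε1
  · have hin : HasDerivAt
        (fun ε : ℝ => inner ℝ (τ + ε • v) (s : EuclideanSpace ℝ (Fin d)))
        (inner ℝ v (s : EuclideanSpace ℝ (Fin d))) ε := by
      simp_rw [inner_add_left, real_inner_smul_left]
      simpa using ((hasDerivAt_id ε).mul_const
        (inner ℝ v (s : EuclideanSpace ℝ (Fin d)))).const_add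
        (inner ℝ τ (s : EuclideanSpace ℝ (Fin d)))
    exact (hasDerivAt_stableUpsilon hα _).scomp ε hin

namespace IsStableVector

variable {Ω : Type*} [MeasurableSpace Ω] {P : Measure Ω} {α : ℝ}
  {Λ : Measure (UnitSphere d)} {μ : EuclideanSpace ℝ (Fin d)}
  {Y : Ω → EuclideanSpace ℝ (Fin d)}

theorem integral_exp_inner (hY : IsStableVector P α Λ μ Y) (τ : EuclideanSpace ℝ (Fin d)) :
    ∫ ω, Complex.exp ((inner ℝ τ (Y ω) : ℝ) * I) ∂P =
      Complex.exp (-(∫ s : UnitSphere d,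
          stableUpsilon α (inner ℝ τ (s : EuclideanSpace ℝ (Fin d))) ∂Λ)
        + I * ((inner ℝ μ τ : ℝ) : ℂ)) := by
  rw [← hY.charFun_eq, charFun_apply, integral_map hY.aemeasurable
    (by fun_prop : Continuous fun x : EuclideanSpace ℝ (Fin d) =>
      Complex.exp ((inner ℝ x τ : ℝ) * I)).aestronglyMeasurable]
  simp_rw [real_inner_comm τ]

theorem aemeasurable_inner (hY : IsStableVector P α Λ μ Y) (v : EuclideanSpace ℝ (Fin d)) :
    AEMeasurable (fun ω => inner ℝ v (Y ω)) P :=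
  (continuous_const.inner continuous_id).measurable.comp_aemeasurable hY.aemeasurable

theorem integrable_inner [IsProbabilityMeasure P] [IsFiniteMeasure Λ] (hα : 1 < α)
    (hY : IsStableVector P α Λ μ Y) (v : EuclideanSpace ℝ (Fin d)) : Integrable (fun ω => inner ℝ v (Y ω)) P := by
  -- Centring removes the linear term of the exponent, which would be of order `|t|` and not
  -- `|t|^α`.
  have hm : AEMeasurable (fun ω => inner ℝ v (Y ω) - inner ℝ μ v) P :=
    (hY.aemeasurable_inner v).sub_const _
  have := Measure.isProbabilityMeasure_map hm
  set C := (‖v‖ ^ α * (1 + |stableTan α|)) * Λ.real Set.univ with hC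
  have hC0 : 0 ≤ C := by positivity
  have hΥ : ∀ t : ℝ, ‖∫ s : UnitSphere d,
      stableUpsilon α (inner ℝ (t • v) (s : EuclideanSpace ℝ (Fin d))) ∂Λ‖ ≤ C * |t| ^ α := by
    intro t
    have : ∀ s : UnitSphere d,
        ‖stableUpsilon α (inner ℝ (t • v) (s : EuclideanSpace ℝ (Fin d)))‖ ≤
          |t| ^ α * (‖v‖ ^ α * (1 + |stableTan α|)) := fun s => by
      refine (norm_stableUpsilon_le _ _).trans ?_
      rw [← mul_assoc, ← Real.mul_rpow (abs_nonneg _) (norm_nonneg _), real_inner_smul_left,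
        abs_mul]
      have := abs_inner_unitSphere_le v s
      have hα0 : 0 < α := by linarith
      gcongr
    refine (norm_integral_le_of_norm_le_const (ae_of_all _ this)).trans_eq ?_
    rw [hC]
    ring
  have hchar : ∀ t : ℝ, charFun (P.map fun ω => inner ℝ v (Y ω) - inner ℝ μ v) t =
      Complex.exp (-(∫ s : UnitSphere d,
        stableUpsilon α (inner ℝ (t • v) (s : EuclideanSpace ℝ (Fin d))) ∂Λ)) := by
    intro t
    rw [charFun_apply_real, integral_map hm
      (by fun_prop : Continuous fun x : ℝ => Complex.exp (t * x * I)).aestronglyMeasurable]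
    have he : ∀ ω, Complex.exp (t * ((inner ℝ v (Y ω) - inner ℝ μ v : ℝ) : ℂ) * I) =
        Complex.exp ((inner ℝ (t • v) (Y ω) : ℝ) * I) *
          Complex.exp (-(I * ((inner ℝ μ (t • v) : ℝ) : ℂ))) := fun ω => by
      rw [← Complex.exp_add, real_inner_smul_left, real_inner_smul_right]
      congr 1
      push_cast
      ring
    simp_rw [he]
    rw [integral_mul_const, hY.integral_exp_inner, ← Complex.exp_add]
    congr 1
    ring
  -- The factor `2` serves both cases: `‖e^z - 1‖ ≤ 2‖z‖` for `‖z‖ ≤ 1`, and `‖1 - φ‖ ≤ 2` when `C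
  -- |t|^α > 1`.
  have hid := integrable_id_of_norm_one_sub_charFun_le
    (ν := P.map fun ω => inner ℝ v (Y ω) - inner ℝ μ v) (C := 2 * C) hα (by positivity)
    (fun t => by
      rcases le_or_gt (C * |t| ^ α) 1 with h1 | h1
      · rw [norm_sub_rev, hchar]
        refine (Complex.norm_exp_sub_one_le (by rw [norm_neg]; exact (hΥ t).trans h1)).trans ?_
        rw [norm_neg, mul_assoc]
        have := hΥ t
        gcongr
      · refine norm_one_sub_charFun_le_two.trans ?_
        linarith)
  have h2 : Integrable (fun ω => inner ℝ v (Y ω) - inner ℝ μ v) P := by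
    have := hid.comp_aemeasurable hm
    exact this
  have h3 := h2.add (integrable_const (inner ℝ μ v))
  refine h3.congr (ae_of_all _ fun ω => ?_)
  simp

/-- The derivative of the characteristic function of a stable vector in the direction `v`. -/
theorem integral_inner_smul_exp [IsProbabilityMeasure P] [IsFiniteMeasure Λ] (hα : 1 < α)
    (hY : IsStableVector P α Λ μ Y) (τ v : EuclideanSpace ℝ (Fin d)) :
    ∫ ω, inner ℝ v (Y ω) • Complex.exp ((inner ℝ τ (Y ω) : ℝ) * I) ∂P =
      Complex.exp (-(∫ s : UnitSphere d,
          stableUpsilon α (inner ℝ τ (s : EuclideanSpace ℝ (Fin d))) ∂Λ)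
        + I * ((inner ℝ μ τ : ℝ) : ℂ)) *
      (I * (∫ s : UnitSphere d, inner ℝ v (s : EuclideanSpace ℝ (Fin d)) •
        stableUpsilonDeriv α (inner ℝ τ (s : EuclideanSpace ℝ (Fin d))) ∂Λ)
        + ((inner ℝ μ v : ℝ) : ℂ)) := by
  have hexp : ∀ ε : ℝ, AEStronglyMeasurable
      (fun ω => Complex.exp ((inner ℝ (τ + ε • v) (Y ω) : ℝ) * I)) P := fun ε =>
    (by fun_prop : Measurable fun x : ℝ => Complex.exp (x * I)).comp_aemeasurable
      (hY.aemeasurable_inner _) |>.aestronglyMeasurable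
  have hin : ∀ (ε : ℝ) (y : EuclideanSpace ℝ (Fin d)),
      HasDerivAt (fun ε : ℝ => inner ℝ (τ + ε • v) y) (inner ℝ v y) ε := fun ε y => by
    simp_rw [inner_add_left, real_inner_smul_left]
    simpa using ((hasDerivAt_id ε).mul_const (inner ℝ v y)).const_add (inner ℝ τ y)
  -- One function of `ε` is differentiated in two ways: under the expectation, dominated by the
  -- integrable `|⟨v, Y⟩|`, and through its explicit exponential form (`hR`). Uniqueness of the
  -- derivative gives the identity, up to a factor `I`.
  have hL := (hasDerivAt_integral_of_dominated_loc_of_deriv_le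
    (F := fun (ε : ℝ) (ω : Ω) => Complex.exp ((inner ℝ (τ + ε • v) (Y ω) : ℝ) * I))
    (F' := fun (ε : ℝ) (ω : Ω) => Complex.exp ((inner ℝ (τ + ε • v) (Y ω) : ℝ) * I) *
      (((inner ℝ v (Y ω) : ℝ) : ℂ) * I))
    (bound := fun ω => ‖inner ℝ v (Y ω)‖)
    (μ := P) (x₀ := (0 : ℝ)) (Metric.ball_mem_nhds 0 one_pos)
    (Eventually.of_forall hexp)
    (Integrable.of_bound (hexp 0) 1 (ae_of_all _ fun ω =>
      (Complex.norm_exp_ofReal_mul_I _).le))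
    ((hexp 0).mul ((hY.aemeasurable_inner v).complex_ofReal.mul_const I).aestronglyMeasurable)
    (ae_of_all _ fun ω ε _ => by
      rw [norm_mul, Complex.norm_exp_ofReal_mul_I, norm_mul, Complex.norm_I, Complex.norm_real,
        one_mul, mul_one])
    (hY.integrable_inner hα v).norm
    (ae_of_all _ fun ω ε _ => (((hin ε (Y ω)).ofReal_comp).mul_const I).cexp)).2
  have hμ : HasDerivAt (fun ε : ℝ => I * ((inner ℝ μ (τ + ε • v) : ℝ) : ℂ))
      (I * ((inner ℝ μ v : ℝ) : ℂ)) 0 := by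
    have := (hin 0 μ).ofReal_comp.const_mul I
    simpa only [real_inner_comm μ] using this
  have hR := ((hasDerivAt_integral_stableUpsilon hα Λ τ v).neg.add hμ).cexp
  simp only [hY.integral_exp_inner] at hL
  have huniq := hL.unique hR
  simp only [zero_smul, add_zero, Pi.add_apply, Pi.neg_apply] at huniq
  have hl : ∫ ω, Complex.exp ((inner ℝ τ (Y ω) : ℝ) * I) * (((inner ℝ v (Y ω) : ℝ) : ℂ) * I) ∂P =
      I * ∫ ω, inner ℝ v (Y ω) • Complex.exp ((inner ℝ τ (Y ω) : ℝ) * I) ∂P := by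
    rw [← integral_const_mul]
    congr 1 with ω
    rw [Complex.real_smul]
    ring
  rw [hl] at huniq
  refine mul_left_cancel₀ Complex.I_ne_zero (huniq.trans ?_)
  linear_combination (-Complex.exp (-(∫ s : UnitSphere d,
    stableUpsilon α (inner ℝ τ (s : EuclideanSpace ℝ (Fin d))) ∂Λ)
    + I * ((inner ℝ μ τ : ℝ) : ℂ)) * (∫ s : UnitSphere d,
      inner ℝ v (s : EuclideanSpace ℝ (Fin d)) •
        stableUpsilonDeriv α (inner ℝ τ (s : EuclideanSpace ℝ (Fin d))) ∂Λ)) * Complex.I_mul_I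

end IsStableVector

end StableVector

/-! ### Specialization to coordinate directions and the regression residual. -/

section Coordinates

open Filter Topology
open Complex (I)

variable {d : ℕ}

theorem abs_coord_unitSphere_le (s : UnitSphere d) (k : Fin d) :
    |(s : EuclideanSpace ℝ (Fin d)) k| ≤ 1 := by
  have h := abs_inner_unitSphere_le (EuclideanSpace.single k (1 : ℝ)) s
  simpa [EuclideanSpace.inner_single_left] using h

theorem measurable_coord_unitSphere (k : Fin d) :
    Measurable fun s : UnitSphere d => (s : EuclideanSpace ℝ (Fin d)) k := by
  have h := (continuous_inner_unitSphere (EuclideanSpace.single k (1 : ℝ))).measurable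
  simpa [EuclideanSpace.inner_single_left] using h

theorem integrable_coord_rpow_sign {p : ℝ} (hp : 0 ≤ p) (Λ : Measure (UnitSphere d))
    [IsFiniteMeasure Λ] (k : Fin d) :
    Integrable (fun s : UnitSphere d => Real.sign ((s : EuclideanSpace ℝ (Fin d)) k)
      * |(s : EuclideanSpace ℝ (Fin d)) k| ^ p) Λ := by
  refine Integrable.of_bound ((Real.measurable_sign.comp (measurable_coord_unitSphere k)).mul
    ((measurable_coord_unitSphere k).abs.pow_const p)).aestronglyMeasurable 1
    (ae_of_all _ fun s => ?_)
  rw [Real.norm_eq_abs, abs_mul]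
  refine mul_le_one₀ (Real.abs_sign_le_one _) (abs_nonneg _) ?_
  rw [abs_of_nonneg (by positivity)]
  exact Real.rpow_le_one (abs_nonneg _) (abs_coord_unitSphere_le s k) hp

theorem integrable_coord_rpow {p : ℝ} (hp : 0 ≤ p) (Λ : Measure (UnitSphere d))
    [IsFiniteMeasure Λ] (k : Fin d) :
    Integrable (fun s : UnitSphere d => |(s : EuclideanSpace ℝ (Fin d)) k| ^ p) Λ := by
  refine Integrable.of_bound
    ((measurable_coord_unitSphere k).abs.pow_const p).aestronglyMeasurable 1
    (ae_of_all _ fun s => ?_)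
  rw [Real.norm_of_nonneg (by positivity)]
  exact Real.rpow_le_one (abs_nonneg _) (abs_coord_unitSphere_le s k) hp

theorem integrable_coord_mul {f : UnitSphere d → ℝ} {Λ : Measure (UnitSphere d)}
    (hf : Integrable f Λ) (k : Fin d) :
    Integrable (fun s : UnitSphere d => (s : EuclideanSpace ℝ (Fin d)) k * f s) Λ :=
  hf.bdd_mul (c := 1) (measurable_coord_unitSphere k).aestronglyMeasurable
    (ae_of_all _ fun s => abs_coord_unitSphere_le s k)

theorem covariation_self {α : ℝ} (hα : 1 < α) (Λ : Measure (UnitSphere d)) (k : Fin d) :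
    covariation α Λ k k = scalePow α Λ k := by
  unfold covariation scalePow
  congr 1 with s
  rw [abs_rpow_eq_mul hα, ← Real.mul_sign_self]
  ring

theorem integral_coord_mul_rpow_self {α : ℝ} (hα : 1 < α) (Λ : Measure (UnitSphere d))
    (k : Fin d) :
    ∫ s : UnitSphere d, (s : EuclideanSpace ℝ (Fin d)) k
        * |(s : EuclideanSpace ℝ (Fin d)) k| ^ (α - 1) ∂Λ =
      ∫ s : UnitSphere d, Real.sign ((s : EuclideanSpace ℝ (Fin d)) k)
        * |(s : EuclideanSpace ℝ (Fin d)) k| ^ α ∂Λ := by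
  congr 1 with s
  rw [abs_rpow_eq_mul hα]
  linear_combination (-|(s : EuclideanSpace ℝ (Fin d)) k| ^ (α - 1)) *
    Real.abs_mul_sign_self ((s : EuclideanSpace ℝ (Fin d)) k)

theorem integral_stableUpsilon_single {α : ℝ} (hα : 1 < α) (Λ : Measure (UnitSphere d))
    [IsFiniteMeasure Λ] (k : Fin d) (t : ℝ) :
    ∫ s : UnitSphere d, stableUpsilon α
        (inner ℝ (EuclideanSpace.single k t) (s : EuclideanSpace ℝ (Fin d))) ∂Λ =
      ((|t| ^ α : ℝ) : ℂ) * ((scalePow α Λ k : ℂ) - I * (stableTan α : ℂ) *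
        ((Real.sign t : ℝ) : ℂ) * ((∫ s : UnitSphere d,
          Real.sign ((s : EuclideanSpace ℝ (Fin d)) k)
            * |(s : EuclideanSpace ℝ (Fin d)) k| ^ α ∂Λ : ℝ) : ℂ)) := by
  have hα0 : 0 ≤ α := by linarith
  have hin : ∀ s : UnitSphere d, inner ℝ (EuclideanSpace.single k t)
      (s : EuclideanSpace ℝ (Fin d)) = t * (s : EuclideanSpace ℝ (Fin d)) k := fun s => by
    simp [EuclideanSpace.inner_single_left]
  simp_rw [hin, stableUpsilon_mul]
  rw [integral_const_mul, integral_sub (integrable_coord_rpow hα0 Λ k).ofReal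
    ((integrable_coord_rpow_sign hα0 Λ k).ofReal.const_mul _), integral_const_mul,
    integral_complex_ofReal, integral_complex_ofReal, scalePow]

theorem integral_stableUpsilonDeriv_single {α : ℝ} (hα : 1 < α) (Λ : Measure (UnitSphere d))
    [IsFiniteMeasure Λ] (j k : Fin d) (t : ℝ) :
    ∫ s : UnitSphere d,
        inner ℝ (EuclideanSpace.single j (1 : ℝ)) (s : EuclideanSpace ℝ (Fin d)) •
        stableUpsilonDeriv α
          (inner ℝ (EuclideanSpace.single k t) (s : EuclideanSpace ℝ (Fin d))) ∂Λ =
      ((α * |t| ^ (α - 1) : ℝ) : ℂ) * (((Real.sign t : ℝ) : ℂ) * (covariation α Λ j k : ℂ)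
        - I * (stableTan α : ℂ) * ((∫ s : UnitSphere d, (s : EuclideanSpace ℝ (Fin d)) j
            * |(s : EuclideanSpace ℝ (Fin d)) k| ^ (α - 1) ∂Λ : ℝ) : ℂ)) := by
  have hα0 : 0 ≤ α - 1 := by linarith
  have hin : ∀ (l : Fin d) (r : ℝ) (s : UnitSphere d), inner ℝ (EuclideanSpace.single l r)
      (s : EuclideanSpace ℝ (Fin d)) = r * (s : EuclideanSpace ℝ (Fin d)) l := fun l r s => by
    simp [EuclideanSpace.inner_single_left]
  have hfun : ∀ s : UnitSphere d,
      inner ℝ (EuclideanSpace.single j (1 : ℝ)) (s : EuclideanSpace ℝ (Fin d)) •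
        stableUpsilonDeriv α
          (inner ℝ (EuclideanSpace.single k t) (s : EuclideanSpace ℝ (Fin d))) =
      ((α * |t| ^ (α - 1) : ℝ) : ℂ) *
        (((Real.sign t : ℝ) : ℂ) * (((s : EuclideanSpace ℝ (Fin d)) j *
          (Real.sign ((s : EuclideanSpace ℝ (Fin d)) k) *
            |(s : EuclideanSpace ℝ (Fin d)) k| ^ (α - 1)) : ℝ) : ℂ)
        - I * (stableTan α : ℂ) * (((s : EuclideanSpace ℝ (Fin d)) j *
            |(s : EuclideanSpace ℝ (Fin d)) k| ^ (α - 1) : ℝ) : ℂ)) := fun s => by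
    rw [hin, hin, one_mul, stableUpsilonDeriv_mul, Complex.real_smul]
    push_cast
    ring
  simp_rw [hfun]
  rw [integral_const_mul, integral_sub
    ((integrable_coord_mul (integrable_coord_rpow_sign hα0 Λ k) j).ofReal.const_mul _)
    ((integrable_coord_mul (integrable_coord_rpow hα0 Λ k) j).ofReal.const_mul _),
    integral_const_mul, integral_const_mul, integral_complex_ofReal, integral_complex_ofReal]
  congr 4
  rw [covariation]
  congr 2 with s
  ring

/-- The characteristic function of a univariate stable law with scale `v = σ^α`,
skewness `β` and location `m`. -/
noncomputable def stableCharFun (α v β m t : ℝ) : ℂ :=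
  Complex.exp (-(((|t| ^ α : ℝ) : ℂ) * ((v : ℂ) - I * (stableTan α : ℂ) *
    ((Real.sign t : ℝ) : ℂ) * ((β * v : ℝ) : ℂ))) + I * ((m * t : ℝ) : ℂ))

namespace IsStableVector

variable {Ω : Type*} [MeasurableSpace Ω] {P : Measure Ω} {α : ℝ}
  {Λ : Measure (UnitSphere d)} {μ : EuclideanSpace ℝ (Fin d)} {Y : Ω → EuclideanSpace ℝ (Fin d)}

theorem aemeasurable_coord (hY : IsStableVector P α Λ μ Y) (k : Fin d) :
    AEMeasurable (fun ω => Y ω k) P := by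
  simpa [EuclideanSpace.inner_single_left] using
    hY.aemeasurable_inner (EuclideanSpace.single k (1 : ℝ))

theorem integrable_coord [IsProbabilityMeasure P] [IsFiniteMeasure Λ] (hα : 1 < α)
    (hY : IsStableVector P α Λ μ Y) (k : Fin d) :
    Integrable (fun ω => Y ω k) P := by
  simpa [EuclideanSpace.inner_single_left] using
    hY.integrable_inner hα (EuclideanSpace.single k (1 : ℝ))

theorem integral_exp_coord [IsFiniteMeasure Λ] (hα : 1 < α) (hY : IsStableVector P α Λ μ Y) {k : Fin d}
    (hσ : 0 < scalePow α Λ k) (t : ℝ) :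
    ∫ ω, Complex.exp (t * Y ω k * I) ∂P =
      stableCharFun α (scalePow α Λ k) (skewness α Λ k) (μ k) t := by
  have h := hY.integral_exp_inner (EuclideanSpace.single k t)
  rw [integral_stableUpsilon_single hα] at h
  simp only [EuclideanSpace.inner_single_left, EuclideanSpace.inner_single_right,
    RCLike.conj_to_real, Complex.ofReal_mul] at h
  rw [h, stableCharFun, skewness, div_mul_cancel₀ _ hσ.ne']
  push_cast
  ring_nf

theorem integral_coord_smul_exp [IsProbabilityMeasure P] [IsFiniteMeasure Λ] (hα : 1 < α)
    (hY : IsStableVector P α Λ μ Y) (j : Fin d)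
    {k : Fin d} (hσ : 0 < scalePow α Λ k) (t : ℝ) :
    ∫ ω, Y ω j • Complex.exp (t * Y ω k * I) ∂P =
      stableCharFun α (scalePow α Λ k) (skewness α Λ k) (μ k) t *
      (I * (((α * |t| ^ (α - 1) : ℝ) : ℂ) *
        (((Real.sign t : ℝ) : ℂ) * (covariation α Λ j k : ℂ)
        - I * (stableTan α : ℂ) * ((∫ s : UnitSphere d, (s : EuclideanSpace ℝ (Fin d)) j
            * |(s : EuclideanSpace ℝ (Fin d)) k| ^ (α - 1) ∂Λ : ℝ) : ℂ)))
        + ((μ j : ℝ) : ℂ)) := by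
  have h := hY.integral_inner_smul_exp hα (EuclideanSpace.single k t)
    (EuclideanSpace.single j (1 : ℝ))
  rw [← hY.integral_exp_inner, integral_stableUpsilonDeriv_single hα] at h
  simp only [EuclideanSpace.inner_single_left, EuclideanSpace.inner_single_right,
    RCLike.conj_to_real, Complex.ofReal_mul, one_mul] at h
  rw [hY.integral_exp_coord hα hσ] at h
  simpa only [Complex.ofReal_mul] using h

theorem integral_coord [IsProbabilityMeasure P] [IsFiniteMeasure Λ] (hα : 1 < α)
    (hY : IsStableVector P α Λ μ Y) (j : Fin d) {k : Fin d}
    (hσ : 0 < scalePow α Λ k) : ∫ ω, Y ω j ∂P = μ j := by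
  -- At `t = 0` the factor `|t|^{α-1}` vanishes because `α > 1`, and only the location remains.
  have h := hY.integral_coord_smul_exp hα j hσ 0
  have h0 : α - 1 ≠ 0 := by linarith
  have h1 : α ≠ 0 := by linarith
  simp [stableCharFun, h0, h1, integral_complex_ofReal] at h
  exact_mod_cast h

/-- The Fourier transform, with respect to `S = Y_k`, of the residual of the linear regression
of `Y_j` on `Y_k`. -/
theorem integral_residual_smul_exp [IsProbabilityMeasure P] [IsFiniteMeasure Λ] (hα : 1 < α)
    (hY : IsStableVector P α Λ μ Y) (j : Fin d)
    {k : Fin d} (hσ : 0 < scalePow α Λ k) (t : ℝ) :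
    ∫ ω, ((Y ω j - μ j) - kappaCoeff α Λ j k * (Y ω k - μ k)) •
        Complex.exp (t * Y ω k * I) ∂P =
      ((stableTan α * scalePow α Λ k *
          (lambdaCoeff α Λ j k - skewness α Λ k * kappaCoeff α Λ j k) : ℝ) : ℂ) *
        (((α * |t| ^ (α - 1) : ℝ) : ℂ) *
          stableCharFun α (scalePow α Λ k) (skewness α Λ k) (μ k) t) := by
  have hexp : Integrable (fun ω => Complex.exp (t * Y ω k * I)) P := by
    refine Integrable.of_bound ((by fun_prop : Measurable fun x : ℝ =>
      Complex.exp (t * x * I)).comp_aemeasurable (hY.aemeasurable_coord k)).aestronglyMeasurable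
      1 (ae_of_all _ fun ω => ?_)
    rw [← Complex.ofReal_mul, Complex.norm_exp_ofReal_mul_I]
  have hint : ∀ l, Integrable (fun ω => Y ω l • Complex.exp (t * Y ω k * I)) P := fun l => by
    refine (hY.integrable_coord hα l).norm.mono
      ((hY.aemeasurable_coord l).aestronglyMeasurable.smul hexp.aestronglyMeasurable)
      (ae_of_all _ fun ω => ?_)
    rw [norm_smul_exp_mul_I]
    simp
  have hsplit : ∀ ω, ((Y ω j - μ j) - kappaCoeff α Λ j k * (Y ω k - μ k)) •
      Complex.exp (t * Y ω k * I) = Y ω j • Complex.exp (t * Y ω k * I)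
        - (kappaCoeff α Λ j k : ℂ) * (Y ω k • Complex.exp (t * Y ω k * I))
        - ((μ j - kappaCoeff α Λ j k * μ k : ℝ) : ℂ) * Complex.exp (t * Y ω k * I) := fun ω => by
    simp only [Complex.real_smul]
    push_cast
    ring
  have hk : Integrable (fun ω => (kappaCoeff α Λ j k : ℂ) *
      (Y ω k • Complex.exp (t * Y ω k * I))) P := (hint k).const_mul _
  have hjk : Integrable (fun ω => Y ω j • Complex.exp (t * Y ω k * I) -
      (kappaCoeff α Λ j k : ℂ) * (Y ω k • Complex.exp (t * Y ω k * I))) P := (hint j).sub hk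
  simp_rw [hsplit]
  -- For `j = k` the covariation is `σ^α` and the other integral is `β σ^α`. After subtracting `κ`
  -- times that case, the `sign t` terms cancel, since `[Y_j, Y_k] = κ σ^α`, and so do the location
  -- terms.
  rw [integral_sub hjk (hexp.const_mul _), integral_sub (hint j) hk, integral_const_mul, integral_const_mul,
    hY.integral_coord_smul_exp hα j hσ, hY.integral_coord_smul_exp hα k hσ,
    hY.integral_exp_coord hα hσ, covariation_self hα, integral_coord_mul_rpow_self hα]
  have e1 : covariation α Λ j k = kappaCoeff α Λ j k * scalePow α Λ k := by
    rw [kappaCoeff, div_mul_cancel₀ _ hσ.ne']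
  have e2 : (∫ s : UnitSphere d, (s : EuclideanSpace ℝ (Fin d)) j
      * |(s : EuclideanSpace ℝ (Fin d)) k| ^ (α - 1) ∂Λ) =
      lambdaCoeff α Λ j k * scalePow α Λ k := by
    rw [lambdaCoeff, div_mul_cancel₀ _ hσ.ne']
  have e3 : (∫ s : UnitSphere d, Real.sign ((s : EuclideanSpace ℝ (Fin d)) k)
      * |(s : EuclideanSpace ℝ (Fin d)) k| ^ α ∂Λ) = skewness α Λ k * scalePow α Λ k := by
    rw [skewness, div_mul_cancel₀ _ hσ.ne']
  rw [e1, e2, e3]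
  push_cast
  linear_combination (-(stableCharFun α (scalePow α Λ k) (skewness α Λ k) (μ k) t * α *
    ((|t| ^ (α - 1) : ℝ) : ℂ) * stableTan α * scalePow α Λ k *
    (lambdaCoeff α Λ j k - skewness α Λ k * kappaCoeff α Λ j k))) * Complex.I_mul_I

end IsStableVector

end Coordinates

/-! ### The function `h` as an inverse Fourier transform. -/

section Density

open Complex (I)

theorem norm_stableCharFun (α v β m t : ℝ) :
    ‖stableCharFun α v β m t‖ = Real.exp (-(v * |t| ^ α)) := by
  rw [stableCharFun, Complex.norm_exp]
  congr 1
  simp [Complex.mul_re, Complex.mul_im]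
  ring

theorem measurable_stableCharFun (α v β m : ℝ) : Measurable (stableCharFun α v β m) := by
  have := Real.measurable_sign
  unfold stableCharFun
  fun_prop

/-- The skewness and location only rotate the phase, so the modulus is `α |t|^{α-1} e^{-v |t|^α}`.
This integrability is what makes inversion available. -/
theorem integrable_rpow_mul_stableCharFun {α v : ℝ} (hα : 0 < α) (hv : 0 < v) (β m : ℝ) :
    Integrable fun t : ℝ => ((α * |t| ^ (α - 1) : ℝ) : ℂ) * stableCharFun α v β m t := by
  have h0 : IntegrableOn (fun t : ℝ => |t| ^ (α - 1) * Real.exp (-v * |t| ^ α))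
      (Set.Ioi 0) :=
    (integrableOn_rpow_mul_exp_neg_mul_rpow (s := α - 1) (by linarith) hα hv).congr_fun
      (fun t ht => by simp only [abs_of_pos (Set.mem_Ioi.1 ht)]) measurableSet_Ioi
  have h1 : IntegrableOn (fun t : ℝ => |t| ^ (α - 1) * Real.exp (-v * |t| ^ α))
      (Set.Iic 0) := by
    have m : MeasurableEmbedding fun x : ℝ => -x := (Homeomorph.neg ℝ).measurableEmbedding
    rw [← Measure.map_neg_eq_self (volume : Measure ℝ), m.integrableOn_map_iff]
    simp only [Function.comp_def, abs_neg, Set.neg_preimage, Set.neg_Iic, neg_zero]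
    exact (integrableOn_Ici_iff_integrableOn_Ioi).2 h0
  have h2 : Integrable fun t : ℝ => |t| ^ (α - 1) * Real.exp (-v * |t| ^ α) := by
    rw [← integrableOn_univ, ← Set.Iic_union_Ioi (a := (0 : ℝ))]
    exact h1.union h0
  refine (h2.const_mul α).mono ?_ (Filter.Eventually.of_forall fun t => ?_)
  · have := measurable_stableCharFun α v β m
    exact Measurable.aestronglyMeasurable (by fun_prop)
  · rw [norm_mul, norm_stableCharFun, Complex.norm_real, Real.norm_eq_abs, Real.norm_eq_abs,
      abs_mul, abs_mul, abs_mul, abs_of_pos (Real.exp_pos _), neg_mul, mul_assoc]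

/-- `h` is the inverse Fourier transform of `α |t|^{α-1} φ_S(t)`. -/
theorem stableH_eq_integral {α v : ℝ} (hα : 0 < α) (hv : 0 < v) (β x : ℝ) :
    (stableH α v β x : ℂ) = ((2 * Real.pi)⁻¹ : ℝ) *
      ∫ u : ℝ, ((α * |u| ^ (α - 1) : ℝ) : ℂ) * stableCharFun α v β 0 u *
        Complex.exp (-(u * x * I)) := by
  set F : ℝ → ℂ := fun u => ((α * |u| ^ (α - 1) : ℝ) : ℂ) * stableCharFun α v β 0 u *
        Complex.exp (-(u * x * I)) with hF
  have hFi : Integrable F := by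
    refine (integrable_rpow_mul_stableCharFun hα hv β 0).mul_bdd (c := 1) (by fun_prop)
      (ae_of_all _ fun u => ?_)
    rw [← Complex.ofReal_mul, ← neg_mul, ← Complex.ofReal_neg, Complex.norm_exp_ofReal_mul_I]
  have hFn : IntegrableOn (fun u => F (-u)) (Set.Ioi 0) := hFi.comp_neg.integrableOn
  -- The values at `u` and `-u` are complex conjugates, so folding the line onto the half-line gives
  -- twice a cosine; hence `α/π` from `α/(2π)`.
  have hsum : ∀ u ∈ Set.Ioi (0 : ℝ), F u + F (-u) =
      ((2 * α * (u ^ (α - 1) * Real.exp (-(v * u ^ α))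
        * Real.cos (x * u - stableTan α * β * v * u ^ α)) : ℝ) : ℂ) := by
    intro u hu
    have hu : 0 < u := hu
    have e1 : F u = ((α * u ^ (α - 1) * Real.exp (-(v * u ^ α)) : ℝ) : ℂ) *
        Complex.exp (-((x * u - stableTan α * β * v * u ^ α : ℝ) : ℂ) * I) := by
      simp only [hF, stableCharFun, abs_of_pos hu, Real.sign_of_pos hu]
      rw [Complex.ofReal_mul _ (Real.exp _), Complex.ofReal_exp, mul_assoc ((α * u ^ (α - 1) : ℝ) : ℂ),
        mul_assoc ((α * u ^ (α - 1) : ℝ) : ℂ), ← Complex.exp_add, ← Complex.exp_add]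
      congr 2
      push_cast
      ring
    have e2 : F (-u) = ((α * u ^ (α - 1) * Real.exp (-(v * u ^ α)) : ℝ) : ℂ) *
        Complex.exp (((x * u - stableTan α * β * v * u ^ α : ℝ) : ℂ) * I) := by
      simp only [hF, stableCharFun, abs_neg, abs_of_pos hu, Real.sign_neg, Real.sign_of_pos hu]
      rw [Complex.ofReal_mul _ (Real.exp _), Complex.ofReal_exp, mul_assoc ((α * u ^ (α - 1) : ℝ) : ℂ),
        mul_assoc ((α * u ^ (α - 1) : ℝ) : ℂ), ← Complex.exp_add, ← Complex.exp_add]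
      congr 2
      push_cast
      ring
    rw [e1, e2, ← mul_add, add_comm (Complex.exp _), ← Complex.two_cos, ← Complex.ofReal_cos]
    push_cast
    ring
  have hint : ∫ u, F u = ∫ u in Set.Ioi (0 : ℝ), (F u + F (-u)) := by
    rw [integral_add hFi.integrableOn hFn, integral_comp_neg_Ioi, neg_zero, add_comm,
      ← setIntegral_union (Set.Iic_disjoint_Ioi le_rfl) measurableSet_Ioi hFi.integrableOn
        hFi.integrableOn, Set.Iic_union_Ioi, setIntegral_univ]
  rw [hint, setIntegral_congr_fun measurableSet_Ioi hsum, integral_complex_ofReal,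
    integral_const_mul, stableH, ← Complex.ofReal_mul]
  have hc : α / Real.pi = (2 * Real.pi)⁻¹ * (2 * α) := by
    have := Real.pi_pos.ne'
    field_simp
  rw [hc, mul_assoc]

end Density

/-! ### Weighted expectations of the residual, and totally skewed spectral measures. -/

section Allocation

open Complex (I)

variable {d : ℕ} {Ω : Type*} [MeasurableSpace Ω] {P : Measure Ω} {α : ℝ} {Λ : Measure (UnitSphere d)} {μ : EuclideanSpace ℝ (Fin d)}
  {Y : Ω → EuclideanSpace ℝ (Fin d)} {w : ℝ → ℝ} {j k : Fin d}

/-- The weighted expectation of the regression residual of `Y_j` on `Y_k`, without location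
parameter. -/
theorem IsStableVector.integral_residual_mul [IsProbabilityMeasure P]
    [IsFiniteMeasure Λ] (hα : 1 < α) (hY : IsStableVector P α Λ 0 Y)
    (hσ : 0 < scalePow α Λ k) (hw : Measurable w)
    (hjw : Integrable (fun ω => Y ω j * w (Y ω k)) P)
    (hkw : Integrable (fun ω => Y ω k * w (Y ω k)) P) {c : ℝ}
    (hc : c = stableTan α * scalePow α Λ k *
      (lambdaCoeff α Λ j k - skewness α Λ k * kappaCoeff α Λ j k)) :
    Integrable (fun x => c * stableH α (scalePow α Λ k) (skewness α Λ k) x * w x) ∧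
      ∫ ω, Y ω j * w (Y ω k) ∂P - kappaCoeff α Λ j k * ∫ ω, Y ω k * w (Y ω k) ∂P =
        c * ∫ x, stableH α (scalePow α Λ k) (skewness α Λ k) x * w x := by
  have hα0 : 0 < α := by linarith
  have hf : Integrable (fun ω => Y ω j - kappaCoeff α Λ j k * Y ω k) P :=
    (hY.integrable_coord hα j).sub ((hY.integrable_coord hα k).const_mul _)
  have hsplit : ∀ ω, (Y ω j - kappaCoeff α Λ j k * Y ω k) * w (Y ω k) =
      Y ω j * w (Y ω k) - kappaCoeff α Λ j k * (Y ω k * w (Y ω k)) := fun ω => by ring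
  have hfw : Integrable (fun ω => (Y ω j - kappaCoeff α Λ j k * Y ω k) * w (Y ω k)) P := by
    simp_rw [hsplit]
    exact hjw.sub (hkw.const_mul _)
  have hfour : ∀ t : ℝ, ∫ ω, (Y ω j - kappaCoeff α Λ j k * Y ω k) •
      Complex.exp (t * Y ω k * I) ∂P = (c : ℂ) * (((α * |t| ^ (α - 1) : ℝ) : ℂ) *
          stableCharFun α (scalePow α Λ k) (skewness α Λ k) 0 t) := fun t => by
    have h := hY.integral_residual_smul_exp hα j hσ t
    rw [← hc] at h
    simpa using h
  -- The constant `c` stays inside the density, so `c = 0` needs no separate treatment.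
  have hinv : ∀ x : ℝ, ((c * stableH α (scalePow α Λ k) (skewness α Λ k) x : ℝ) : ℂ) =
      ((2 * Real.pi)⁻¹ : ℝ) * ∫ u : ℝ, (c : ℂ) * (((α * |u| ^ (α - 1) : ℝ) : ℂ) *
          stableCharFun α (scalePow α Λ k) (skewness α Λ k) 0 u) *
            Complex.exp (-(u * x * I)) := fun x => by
    rw [Complex.ofReal_mul, stableH_eq_integral hα0 hσ]
    simp_rw [mul_assoc (c : ℂ), integral_const_mul]
    ring
  obtain ⟨h1, h2⟩ := integral_mul_comp_eq_integral_density hf (hY.aemeasurable_coord k)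
    ((integrable_rpow_mul_stableCharFun hα0 hσ (skewness α Λ k) 0).const_mul (c : ℂ)) hfour
    hinv hw hfw
  refine ⟨h1, ?_⟩
  simp_rw [hsplit] at h2
  rw [integral_sub hjw (hkw.const_mul _), integral_const_mul] at h2
  rw [h2, ← integral_const_mul]
  congr 1 with x
  ring

/-- If `λ = β κ`, the weighted expectation of `Y_j` is linear in that of `Y_k`. -/
theorem IsStableVector.integral_coord_mul_of_lambdaCoeff_eq [IsProbabilityMeasure P]
    [IsFiniteMeasure Λ] (hα : 1 < α)
    (hY : IsStableVector P α Λ μ Y) (hσ : 0 < scalePow α Λ k) (hw : Measurable w)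
    (hwk : Integrable (fun ω => w (Y ω k)) P)
    (hjw : Integrable (fun ω => Y ω j * w (Y ω k)) P)
    (hkw : Integrable (fun ω => Y ω k * w (Y ω k)) P)
    (hc : lambdaCoeff α Λ j k = skewness α Λ k * kappaCoeff α Λ j k) :
    ∫ ω, Y ω j * w (Y ω k) ∂P = μ j * ∫ ω, w (Y ω k) ∂P +
      kappaCoeff α Λ j k * (∫ ω, Y ω k * w (Y ω k) ∂P - μ k * ∫ ω, w (Y ω k) ∂P) := by
  have hf : Integrable (fun ω => (Y ω j - μ j) - kappaCoeff α Λ j k * (Y ω k - μ k)) P :=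
    ((hY.integrable_coord hα j).sub (integrable_const _)).sub
      (((hY.integrable_coord hα k).sub (integrable_const _)).const_mul _)
  have hsplit : ∀ ω, ((Y ω j - μ j) - kappaCoeff α Λ j k * (Y ω k - μ k)) * w (Y ω k) =
      (Y ω j * w (Y ω k) - kappaCoeff α Λ j k * (Y ω k * w (Y ω k))) -
        (μ j - kappaCoeff α Λ j k * μ k) * w (Y ω k) := fun ω => by ring
  have hjk : Integrable (fun ω => Y ω j * w (Y ω k) -
      kappaCoeff α Λ j k * (Y ω k * w (Y ω k))) P := hjw.sub (hkw.const_mul _)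
  have hfw : Integrable (fun ω =>
      ((Y ω j - μ j) - kappaCoeff α Λ j k * (Y ω k - μ k)) * w (Y ω k)) P := by
    simp_rw [hsplit]
    exact hjk.sub (hwk.const_mul _)
  -- The transform of the residual is identically zero, so inversion applies with the zero density.
  have hz := (integral_mul_comp_eq_integral_density hf (hY.aemeasurable_coord k)
    (g := fun _ => 0) (h := fun _ => 0) (integrable_zero _ _ _)
    (fun t => by rw [hY.integral_residual_smul_exp hα j hσ t, hc]; simp)
    (fun x => by simp) hw hfw).2
  simp_rw [hsplit] at hz
  rw [integral_sub hjk (hwk.const_mul _), integral_sub hjw (hkw.const_mul _),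
    integral_const_mul, integral_const_mul] at hz
  simp only [zero_mul, integral_zero] at hz
  linear_combination hz

/-- A totally skewed coordinate is almost everywhere nonnegative under the spectral measure. -/
theorem ae_nonneg_of_skewness_eq_one [IsFiniteMeasure Λ] (hα : 0 ≤ α) (hσ : 0 < scalePow α Λ k)
    (hβ : skewness α Λ k = 1) :
    ∀ᵐ s : UnitSphere d ∂Λ, 0 ≤ (s : EuclideanSpace ℝ (Fin d)) k := by
  rw [skewness, div_eq_one_iff_eq hσ.ne', scalePow] at hβ
  have h1 := integrable_coord_rpow hα Λ k
  have h2 := integrable_coord_rpow_sign hα Λ k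
  -- `β = 1` says that `(1 - sign s_k) |s_k|^α` has integral zero. It is nonnegative, and equals `2
  -- |s_k|^α > 0` where `s_k < 0`.
  have h0 : ∫ s : UnitSphere d, (|(s : EuclideanSpace ℝ (Fin d)) k| ^ α -
      Real.sign ((s : EuclideanSpace ℝ (Fin d)) k) *
        |(s : EuclideanSpace ℝ (Fin d)) k| ^ α) ∂Λ = 0 := by
    rw [integral_sub h1 h2, hβ, sub_self]
  have h3 : Integrable (fun s : UnitSphere d => |(s : EuclideanSpace ℝ (Fin d)) k| ^ α -
      Real.sign ((s : EuclideanSpace ℝ (Fin d)) k) *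
        |(s : EuclideanSpace ℝ (Fin d)) k| ^ α) Λ := h1.sub h2
  rw [integral_eq_zero_iff_of_nonneg (fun s => ?_) h3] at h0
  · filter_upwards [h0] with s hs
    by_contra! hneg
    have hpos : 0 < |(s : EuclideanSpace ℝ (Fin d)) k| ^ α :=
      Real.rpow_pos_of_pos (abs_pos.2 hneg.ne) α
    simp only [Real.sign_of_neg hneg, Pi.zero_apply] at hs
    linarith
  · have hp : 0 ≤ |(s : EuclideanSpace ℝ (Fin d)) k| ^ α := by positivity
    have := mul_le_mul_of_nonneg_right
      ((le_abs_self _).trans (Real.abs_sign_le_one ((s : EuclideanSpace ℝ (Fin d)) k))) hp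
    simp only [Pi.zero_apply]
    linarith

/-- The two integrands differ only by the factor `sign s_k`, which matters only where `s_k < 0`: at
`s_k = 0` both vanish, since `α - 1 ≠ 0`. -/
theorem lambdaCoeff_eq_kappaCoeff (hα : 1 < α)
    (h : ∀ᵐ s : UnitSphere d ∂Λ, 0 ≤ (s : EuclideanSpace ℝ (Fin d)) k) :
    lambdaCoeff α Λ j k = kappaCoeff α Λ j k := by
  rw [lambdaCoeff, kappaCoeff, covariation]
  congr 1
  refine integral_congr_ae ?_
  filter_upwards [h] with s hs
  rcases hs.eq_or_lt with h0 | h0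
  · have : α - 1 ≠ 0 := by linarith
    simp [← h0, Real.zero_rpow this]
  · rw [Real.sign_of_pos h0, mul_one]

theorem discreteSpectral_apply_ne_zero {m : ℕ} {γ : Fin m → ℝ} {s : Fin m → UnitSphere d}
    (hγ : ∀ l, 0 < γ l) (l : Fin m) : discreteSpectral γ s {s l} ≠ 0 := by
  rw [discreteSpectral, Measure.finsetSum_apply]
  intro h
  rw [Finset.sum_eq_zero_iff] at h
  have := h l (Finset.mem_univ l)
  simp [(hγ l).not_ge] at this

/-- Each atom has positive mass, so no null set contains it. -/
theorem mem_of_ae_discreteSpectral {m : ℕ} {γ : Fin m → ℝ} {s : Fin m → UnitSphere d}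
    (hγ : ∀ l, 0 < γ l) {p : UnitSphere d → Prop} (h : ∀ᵐ x ∂(discreteSpectral γ s), p x)
    (l : Fin m) : p (s l) := by
  by_contra hl
  exact discreteSpectral_apply_ne_zero hγ l
    (measure_mono_null (Set.singleton_subset_iff.2 hl) (ae_iff.1 h))

end Allocation

/-! ### The allocation formulas for the loss vector. -/

theorem lossVector_castSucc {Ω : Type*} {n : ℕ} (X : Fin n → Ω → ℝ) (S : Ω → ℝ) (ω : Ω) (i : Fin n) :
    lossVector X S ω i.castSucc = X i ω := by
  simp [lossVector]

theorem lossVector_last {Ω : Type*} {n : ℕ} (X : Fin n → Ω → ℝ) (S : Ω → ℝ) (ω : Ω) :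
    lossVector X S ω (Fin.last n) = S ω := by
  simp [lossVector]

theorem mainTheorem2 {Ω : Type*} [MeasurableSpace Ω] (P : Measure Ω) [IsProbabilityMeasure P]
    (α : ℝ) (hα1 : 1 < α) (hα2 : α ≤ 2) {n : ℕ} (X : Fin n → Ω → ℝ) (S : Ω → ℝ)
    (Λ : Measure (UnitSphere (n + 1))) [IsFiniteMeasure Λ]
    (μ : EuclideanSpace ℝ (Fin (n + 1)))
    (hXS : IsStableVector P α Λ μ (lossVector X S))
    (hσ : 0 < scalePow α Λ (Fin.last n))
    (i : Fin n) (w : ℝ → ℝ) (hw : Measurable w)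
    (hwS : Integrable (fun ω => w (S ω)) P) (hwpos : 0 < ∫ ω, w (S ω) ∂P)
    (hSw : Integrable (fun ω => S ω * w (S ω)) P)
    (hXw : Integrable (fun ω => X i ω * w (S ω)) P) :
    -- the general formula, without location parameter
    (μ = 0 →
      (stableTan α * scalePow α Λ (Fin.last n)
          * (lambdaCoeff α Λ i.castSucc (Fin.last n)
            - skewness α Λ (Fin.last n) * kappaCoeff α Λ i.castSucc (Fin.last n)) ≠ 0 →
        Integrable (fun x : ℝ =>
          stableH α (scalePow α Λ (Fin.last n)) (skewness α Λ (Fin.last n)) x * w x)) ∧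
      weightedAllocation P w (X i) S =
        kappaCoeff α Λ i.castSucc (Fin.last n) * weightedRisk P w S
        + stableTan α * scalePow α Λ (Fin.last n)
          * (lambdaCoeff α Λ i.castSucc (Fin.last n)
            - skewness α Λ (Fin.last n) * kappaCoeff α Λ i.castSucc (Fin.last n))
          * ((∫ x : ℝ, stableH α (scalePow α Λ (Fin.last n)) (skewness α Λ (Fin.last n)) x * w x)
            / ∫ ω, w (S ω) ∂P)) ∧
    -- the model: discrete spectral measure, `S` totally skewed to the right
    (∀ (m : ℕ) (γ : Fin m → ℝ) (s : Fin m → UnitSphere (n + 1)), (∀ j, 0 < γ j) →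
      Λ = discreteSpectral γ s → skewness α Λ (Fin.last n) = 1 →
      (∀ j, 0 ≤ (s j : EuclideanSpace ℝ (Fin (n + 1))) (Fin.last n)) ∧
      lambdaCoeff α Λ i.castSucc (Fin.last n) = kappaCoeff α Λ i.castSucc (Fin.last n) ∧
      (μ = 0 → weightedAllocation P w (X i) S =
        kappaCoeff α Λ i.castSucc (Fin.last n) * weightedRisk P w S) ∧
      Integrable (X i) P ∧ Integrable S P ∧
      weightedAllocation P w (X i) S =
        (∫ ω, X i ω ∂P)
        + kappaCoeff α Λ i.castSucc (Fin.last n) * (weightedRisk P w S - ∫ ω, S ω ∂P)) := by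
  have hα0 : 0 ≤ α := by linarith
  have hXw' : Integrable (fun ω => lossVector X S ω i.castSucc *
      w (lossVector X S ω (Fin.last n))) P := by
    simpa only [lossVector_castSucc, lossVector_last] using hXw
  have hSw' : Integrable (fun ω => lossVector X S ω (Fin.last n) *
      w (lossVector X S ω (Fin.last n))) P := by
    simpa only [lossVector_last] using hSw
  have hwS' : Integrable (fun ω => w (lossVector X S ω (Fin.last n))) P := by
    simpa only [lossVector_last] using hwS
  refine ⟨fun hμ => ?_, fun m γ s hγ hΛ hβ => ?_⟩
  · subst hμ
    obtain ⟨hi, he⟩ := hXS.integral_residual_mul hα1 hσ hw hXw' hSw' rfl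
    simp only [lossVector_castSucc, lossVector_last] at he
    refine ⟨fun hc => ?_, ?_⟩
    -- Only `c h w` is known to be integrable, and `c` can be divided out only when it is nonzero.
    -- For `c = 0` the term in the formula is `0` whatever value the integral of `h w` takes.
    · simp_rw [mul_assoc _ (stableH _ _ _ _)] at hi
      exact (integrable_const_mul_iff (isUnit_iff_ne_zero.2 hc) _).1 hi
    · rw [weightedAllocation, weightedRisk, ← mul_div_assoc, ← mul_div_assoc, ← add_div, ← he]
      congr 1
      ring
  · have hae := ae_nonneg_of_skewness_eq_one hα0 hσ hβ
    have hlk : lambdaCoeff α Λ i.castSucc (Fin.last n) = kappaCoeff α Λ i.castSucc (Fin.last n) :=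
      lambdaCoeff_eq_kappaCoeff hα1 hae
    have hX := hXS.integral_coord hα1 i.castSucc hσ
    have hS := hXS.integral_coord hα1 (Fin.last n) hσ
    have hXi := hXS.integrable_coord hα1 i.castSucc
    have hSi := hXS.integrable_coord hα1 (Fin.last n)
    have he := hXS.integral_coord_mul_of_lambdaCoeff_eq hα1 hσ hw hwS' hXw' hSw'
      (by rw [hβ, one_mul, hlk])
    simp only [lossVector_castSucc, lossVector_last] at hX hS hXi hSi he
    refine ⟨fun j => mem_of_ae_discreteSpectral hγ (hΛ ▸ hae) j, hlk, fun hμ => ?_, hXi, hSi, ?_⟩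
    · subst hμ
      rw [weightedAllocation, weightedRisk, he]
      simp [mul_div_assoc]
    -- The locations are the means, so the linear relation with `μ` becomes the one with
    -- expectations.
    · rw [weightedAllocation, weightedRisk, he, hX, hS]
      have := hwpos.ne'
      field_simp
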